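/- Let $d,q\in\mathbb N$ with $d,q\ge 1$, and let $\kappa>0$. There exist $\sigma_0>0$ and $C<\infty$, depending only on $d,q,\kappa$, such that the following holds. Let $\Omega\subset\mathbb R^d$ be open, and let $(\mathcal T^\delta)_{\delta\in\Delta}$ and $(\mathcal T_S^\delta)_{\delta\in\Delta}$ be families of conforming partitions of $\overline\Omega$ into finitely many closed non-degenerate $d$-simplices. (Conforming: any two simplices of a partition intersect exactly in the convex hull of their common vertices, which may be empty. The interiors of the simplices are contained in $\Omega$.) Assume that: * both families are uniformly shape regular with constant $\kappa$, i.e. every simplex $T$ of each partition contains a ball of some radius $r>0$ with $\operatorname{diam}T\le\kappa r$; * for each $\delta$, $\mathcal T_S^\delta$ is a refinement of $\mathcal T^\delta$, i.e. every $T\in\mathcal T_S^\delta$ is contained in some $T'\in\mathcal T^\delta$; * the refinement has some fixed maximal depth: there is $c>0$ such that $|T|\ge c|T'|$ for all $\delta\in\Delta$ and all $T\in\mathcal T_S^\delta$, $T'\in\mathcal T^\delta$ with $T\subset T'$; * if $d=1$, then both families have the uniform $K$-mesh property: for each of the two families there is a constant $K$ such that $|T|\le K|U|$ whenever $T,U$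 belong to the same partition of that family and $T\cap U\ne\emptyset$; * the refinement is sufficiently deep: $$\sigma:=\sup_{\delta\in\Delta}\ \sup_{T'\in\mathcal T^\delta}\ \sup_{\{T\in\mathcal T_S^\delta:\,T\subset T'\}}\frac{|T|}{|T'|}\le\sigma_0 .$$ For such a partition $\mathcal T$, let $\mathcal S^{-1,q}_{\mathcal T}\subset L_2(\Omega)$ be the space of functions that on each $T\in\mathcal T$ coincide with a polynomial of total degree at most $q$, let $\mathcal S^{0,q}_{\mathcal T,0}:=\mathcal S^{-1,q}_{\mathcal T}\cap H^1_0(\Omega)$, and let $\partial\mathcal T:=\bigcup_{T\in\mathcal T}\partial T$. Then there exist bounded linear projectors $P_q^\delta\colon L_2(\Omega)\to L_2(\Omega)$ $(\delta\in\Delta)$ such that, for all $\delta\in\Delta$, with $(P_q^\delta)'$ denoting the $L_2(\Omega)$-adjoint, $$\operatorname{ran}(P_q^\delta)'\supseteq\mathcal S^{-1,q}_{\mathcal T^\delta},\qquad \operatorname{ran}P_q^\delta\subseteq\{w\in\mathcal S^{0,q}_{\mathcal T_S^\delta,0}: w|_{\partial\mathcal T^\delta}=0\},$$ $$\|P_q^\delta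 w\|_{L_2(T')}\le C\,\|w\|_{L_2(T')}\qquad(T'\in\mathcal T^\delta,\ w\in L_2(\Omega)).$$ Here $w|_{\partial\mathcal T^\delta}=0$ means that $w$ has a representative that is continuous on $\overline\Omega$ and vanishes at every point of $\partial\mathcal T^\delta$. -/

import Mathlib

open MeasureTheory
open scoped ENNReal NNReal ContDiff

noncomputable section

namespace BiorthProj

/-- Euclidean space `ℝ^d`. -/
abbrev E (d : ℕ) := EuclideanSpace ℝ (Fin d)

/-- The real Hilbert space `L_2(Ω)`. -/
abbrev L2 {d : ℕ} (Ω : Set (E d)) := Lp ℝ 2 (volume.restrict Ω)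

/-- The closed simplex with vertex set `T`. -/
def hull {d : ℕ} (T : Finset (E d)) : Set (E d) := convexHull ℝ (T : Set (E d))

/-- A (finite) conforming partition of the closure of `Ω` into closed nondegenerate `d`-simplices.
An element is recorded by its set of `d + 1` vertices. Conformity: two elements intersect
exactly in the simplex spanned by their common vertices (possibly empty). The open elements lie
in `Ω`; this is automatic when `Ω` is the interior of its closure. -/
structure ConformingMesh {d : ℕ} (Ω : Set (E d)) where
  elems : Finset (Finset (E d))
  card_eq : ∀ T ∈ elems, T.card = d + 1
  indep : ∀ T ∈ elems, AffineIndependent ℝ ((↑) : T → E d)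
  inter_eq : ∀ T ∈ elems, ∀ U ∈ elems,
    hull T ∩ hull U = convexHull ℝ ((T : Set (E d)) ∩ (U : Set (E d)))
  cover : ⋃ T ∈ elems, hull T = closure Ω
  interior_subset : ∀ T ∈ elems, interior (hull T) ⊆ Ω

variable {d : ℕ} {Ω : Set (E d)}

/-- Shape regularity with constant `κ`: every element contains a ball whose radius `r`
satisfies `diam T ≤ κ r`. -/
def ConformingMesh.ShapeRegular (𝒯 : ConformingMesh Ω) (κ : ℝ) : Prop :=
  ∀ T ∈ 𝒯.elems, ∃ (x : E d) (r : ℝ), 0 < r ∧ Metric.closedBall x r ⊆ hull T ∧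
    Metric.diam (hull T) ≤ κ * r

/-- `𝒮` is a refinement of `𝒯`: each element of `𝒮` is contained in an element of `𝒯`. -/
def ConformingMesh.Refines (𝒮 𝒯 : ConformingMesh Ω) : Prop :=
  ∀ T ∈ 𝒮.elems, ∃ T' ∈ 𝒯.elems, hull T ⊆ hull T'

/-- The mesh skeleton: the union of the boundaries of the elements. -/
def ConformingMesh.skeleton (𝒯 : ConformingMesh Ω) : Set (E d) :=
  ⋃ T ∈ 𝒯.elems, frontier (hull T)

/-- Uniform `K`-mesh property: touching elements have uniformly comparable sizes. -/
def UniformKMesh {Δ : Type*} (𝒯 : Δ → ConformingMesh Ω) : Prop :=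
  ∃ K : ℝ≥0, ∀ δ, ∀ T ∈ (𝒯 δ).elems, ∀ U ∈ (𝒯 δ).elems, (hull T ∩ hull U).Nonempty →
    volume (hull T) ≤ K * volume (hull U)

/-- Fixed maximal refinement depth: `|T| ≥ c |T'|` for fine elements `T` inside coarse `T'`,
with `c > 0` independent of `δ`. -/
def FixedMaximalDepth {Δ : Type*} (𝒮 𝒯 : Δ → ConformingMesh Ω) : Prop :=
  ∃ c : ℝ≥0, 0 < c ∧ ∀ δ, ∀ T' ∈ (𝒯 δ).elems, ∀ T ∈ (𝒮 δ).elems, hull T ⊆ hull T' →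
    c * volume (hull T') ≤ volume (hull T)

/-- The number `σ`: the supremum of `|T| / |T'|` over all `δ` and all fine elements `T`
contained in a coarse element `T'`. -/
def refinementRatio {Δ : Type*} (𝒮 𝒯 : Δ → ConformingMesh Ω) : ℝ≥0∞ :=
  ⨆ δ, ⨆ T' ∈ (𝒯 δ).elems, ⨆ T ∈ (𝒮 δ).elems, ⨆ _ : hull T ⊆ hull T',
    volume (hull T) / volume (hull T')

/-- `S^{-1,q}_𝒯`: functions in `L_2(Ω)` that on each element agree (almost everywhere) with a
polynomial of total degree at most `q`. -/
def ConformingMesh.brokenPoly (𝒯 : ConformingMesh Ω) (q : ℕ) : Set (L2 Ω) :=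
  {f | ∀ T ∈ 𝒯.elems, ∃ p : MvPolynomial (Fin d) ℝ, p.totalDegree ≤ q ∧
    ∀ᵐ x ∂(volume.restrict Ω), x ∈ hull T → f x = MvPolynomial.eval (fun i => x i) p}

/-- The Sobolev space `H^1_0(Ω)` inside `L_2(Ω)`: the closure of `C_c^∞(Ω)` in the `H^1`-norm.
The functions `g i` in the definition are then the weak partial derivatives of `f`. -/
def H10 (Ω : Set (E d)) : Set (L2 Ω) :=
  {f | ∃ g : Fin d → L2 Ω, ∀ ε : ℝ≥0, 0 < ε → ∃ φ : E d → ℝ,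
    ContDiff ℝ ∞ φ ∧ HasCompactSupport φ ∧ tsupport φ ⊆ Ω ∧
    eLpNorm (fun x => f x - φ x) 2 (volume.restrict Ω) ≤ ε ∧
    ∀ i, eLpNorm (fun x => g i x - fderiv ℝ φ x (EuclideanSpace.single i 1)) 2
      (volume.restrict Ω) ≤ ε}

/-- `S^{0,q}_{𝒯,0} = S^{-1,q}_𝒯 ∩ H^1_0(Ω)`. -/
def ConformingMesh.conformingPoly (𝒯 : ConformingMesh Ω) (q : ℕ) : Set (L2 Ω) :=
  𝒯.brokenPoly q ∩ H10 Ω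

/-- `w|_{∂𝒯} = 0`: `w` has a representative that is continuous on the closure of `Ω` and vanishes
at every point of the skeleton of `𝒯`. -/
def ConformingMesh.VanishesOnSkeleton (𝒯 : ConformingMesh Ω) (w : L2 Ω) : Prop :=
  ∃ v : E d → ℝ, ContinuousOn v (closure Ω) ∧ (∀ᵐ x ∂(volume.restrict Ω), w x = v x) ∧
    ∀ x ∈ 𝒯.skeleton, v x = 0

end BiorthProj

end

/-!
On a coarse element `T` the projector is dual to the polynomials of degree at most `q`: one looks
for functions `ψ_a`, depending linearly on the coordinates `a` of a polynomial `p_a`, that belong to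
the fine finite element space, vanish on and outside the boundary of `T`, and for which the bilinear
form `∫_T p_a ψ_b` is uniformly coercive. Then `P w` is, on `T`, the unique `ψ_b` having the same
moments `∫_T p_a w` as `w`, for all `a`. Equality of moments for all polynomials says that
`adjoint P` fixes the broken polynomials, and coercivity bounds `b`, hence `P w`, by the `L_2`-norm
of `w` on `T` (`exists_biorthogonal_projector`, `eLpNorm_bubble_le`).

By shape regularity `T` contains a ball `closedBall x₀ r` of comparable size. Take a smooth cutoff
function `χ` that is `1` on the ball of radius `r / 4` and supported in the ball of radius `r / 2`,
and let `ψ_a` be the continuous piecewise affine interpolant of `χ p_a` at the vertices of the fine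
mesh. As `1 ≤ q` it is an admissible finite element function. If the fine elements in `T` have
diameter at most `r / 4`, it vanishes outside the ball of radius `3 r / 4`, so it belongs to `H^1_0`
and vanishes on the coarse skeleton. Coercivity holds for `χ p_a` in place of `ψ_a`, because the
`L_2`-norm on a ball is a norm on polynomials (`exists_coercive_refPoly`), and the interpolation
error is at most the Lipschitz constant of `χ p_a` times the fine mesh size, so it is absorbed if
that size is a small multiple of `r` (`le_inner_polyL2_bubbleL2`). After rescaling to `x₀ = 0`,
`r = 1` all constants depend only on `d`, `q` and `κ`. Finally, shape regularity turns a small ratio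
of volumes into a small ratio of diameters (`exists_isReferenceBall`).

That a compactly supported continuous piecewise affine function belongs to the closure of
`C_c^∞(Ω)` is shown by mollification: the function is Lipschitz, so the gradients of its
mollifications are bounded, and they are eventually equal to its own gradient at each interior point
of an element (`mem_H10_of_lipschitz_of_locally_affine`).
-/

noncomputable section

namespace BiorthProj

section

/-! ### Polynomials on a reference ball -/

lemma totalDegree_bind₁_le {σ τ : Type*} (f : σ → MvPolynomial τ ℝ)
    (hf : ∀ i, (f i).totalDegree ≤ 1) (p : MvPolynomial σ ℝ) :
    (MvPolynomial.bind₁ f p).totalDegree ≤ p.totalDegree := by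
  have h : MvPolynomial.bind₁ f p =
      ∑ s ∈ p.support, MvPolynomial.C (p.coeff s) * ∏ i ∈ s.support, f i ^ s i := by
    rw [MvPolynomial.bind₁, MvPolynomial.aeval_def, MvPolynomial.eval₂_eq]
    rfl
  rw [h]
  refine MvPolynomial.totalDegree_finsetSum_le fun s hs => ?_
  refine (MvPolynomial.totalDegree_mul _ _).trans ?_
  rw [MvPolynomial.totalDegree_C, zero_add]
  refine (MvPolynomial.totalDegree_finsetProd _ _).trans ?_
  refine le_trans (Finset.sum_le_sum fun i _ => ?_) (MvPolynomial.le_totalDegree hs)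
  exact (MvPolynomial.totalDegree_pow _ _).trans
    ((Nat.mul_le_mul_left _ (hf i)).trans (by simp))

/-- The number of degrees of freedom of polynomials in `d` variables of total degree at most
`q`. -/
abbrev polyDim (d q : ℕ) : ℕ :=
  Module.finrank ℝ (MvPolynomial.restrictTotalDegree (Fin d) ℝ q)

/-- The coordinates of the polynomials of total degree at most `q` in a fixed basis. -/
def polyOfCoord (d q : ℕ) :
    (Fin (polyDim d q) → ℝ) ≃ₗ[ℝ] MvPolynomial.restrictTotalDegree (Fin d) ℝ q :=
  (Module.finBasis ℝ (MvPolynomial.restrictTotalDegree (Fin d) ℝ q)).equivFun.symm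

/-- The polynomial function on `ℝ^d` with coordinates `a`, as a linear function of `a`. -/
def refPoly {d : ℕ} (q : ℕ) (y : E d) : (Fin (polyDim d q) → ℝ) →ₗ[ℝ] ℝ :=
  (MvPolynomial.aeval (fun i => y i)).toLinearMap ∘ₗ
    (MvPolynomial.restrictTotalDegree (Fin d) ℝ q).subtype ∘ₗ (polyOfCoord d q).toLinearMap

variable {d q : ℕ}

lemma refPoly_apply (y : E d) (a : Fin (polyDim d q) → ℝ) :
    refPoly q y a = MvPolynomial.eval (fun i => y i) (polyOfCoord d q a : MvPolynomial _ ℝ) := by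
  simp [refPoly]

lemma contDiff_eval (p : MvPolynomial (Fin d) ℝ) :
    ContDiff ℝ ∞ fun y : E d => MvPolynomial.eval (fun i => y i) p := by
  induction p using MvPolynomial.induction_on with
  | C a => simpa using contDiff_const
  | add p q hp hq => simpa using hp.add hq
  | mul_X p i hp => simpa using hp.mul (contDiff_euclidean.1 contDiff_id i)

lemma contDiff_refPoly (a : Fin (polyDim d q) → ℝ) :
    ContDiff ℝ ∞ fun y : E d => refPoly q y a := by
  simpa only [refPoly_apply] using contDiff_eval _

lemma refPoly_eq_sum (y : E d) (a : Fin (polyDim d q) → ℝ) :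
    refPoly q y a = ∑ i, a i * refPoly q y (Pi.single i 1) := by
  conv_lhs => rw [← Finset.univ_sum_single a, map_sum]
  refine Finset.sum_congr rfl fun i _ => ?_
  rw [← smul_eq_mul, ← map_smul, ← Pi.single_smul, smul_eq_mul, mul_one]

/-- Every polynomial of degree at most `q` is a reference polynomial in the rescaled variable. -/
lemma exists_refPoly_rescale (p : MvPolynomial (Fin d) ℝ) (hp : p.totalDegree ≤ q) (x₀ : E d)
    {r : ℝ} (hr : r ≠ 0) :
    ∃ a : Fin (polyDim d q) → ℝ,
      ∀ x : E d, MvPolynomial.eval (fun i => x i) p = refPoly q (r⁻¹ • (x - x₀)) a := by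
  set f : Fin d → MvPolynomial (Fin d) ℝ := fun i =>
    MvPolynomial.C (x₀ i) + MvPolynomial.C r * MvPolynomial.X i
  have hf : ∀ i, (f i).totalDegree ≤ 1 := fun i => by
    refine (MvPolynomial.totalDegree_add _ _).trans (max_le (by simp) ?_)
    refine (MvPolynomial.totalDegree_mul _ _).trans ?_
    simp
  have hm : MvPolynomial.bind₁ f p ∈ MvPolynomial.restrictTotalDegree (Fin d) ℝ q :=
    (MvPolynomial.mem_restrictTotalDegree _ _ _).2 ((totalDegree_bind₁_le f hf p).trans hp)
  refine ⟨(polyOfCoord d q).symm ⟨_, hm⟩, fun x => ?_⟩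
  rw [refPoly_apply, LinearEquiv.apply_symm_apply]
  have := MvPolynomial.eval₂Hom_bind₁ (RingHom.id ℝ) (fun i => (r⁻¹ • (x - x₀)) i) f p
  change _ = MvPolynomial.eval₂Hom (RingHom.id ℝ) (fun i => (r⁻¹ • (x - x₀)) i) _
  rw [this]
  change MvPolynomial.eval₂Hom (RingHom.id ℝ) _ p = _
  congr 2
  ext i
  simp [f, mul_inv_cancel_left₀ hr]

/-- A polynomial that vanishes near the origin is zero. -/
lemma eq_zero_of_refPoly_eq_zero {ρ : ℝ} (hρ : 0 < ρ) (a : Fin (polyDim d q) → ℝ)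
    (h : ∀ y ∈ Metric.ball (0 : E d) ρ, refPoly q y a = 0) : a = 0 := by
  have ho : IsOpen ((WithLp.toLp 2 : (Fin d → ℝ) → E d) ⁻¹' Metric.ball 0 ρ) :=
    Metric.isOpen_ball.preimage (PiLp.continuous_toLp 2 _)
  obtain ⟨ε, hε, hsub⟩ := Metric.isOpen_iff.1 ho 0 (by simpa using hρ)
  have hz : (polyOfCoord d q a : MvPolynomial (Fin d) ℝ) = 0 := by
    refine MvPolynomial.funext_set (fun _ => Metric.ball (0 : ℝ) ε) (fun i => ?_) fun y hy => ?_
    · rw [Real.ball_eq_Ioo]; exact Set.Ioo_infinite (by linarith)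
    · have hy' : y ∈ Metric.ball (0 : Fin d → ℝ) ε := by
        rw [ball_pi _ hε]; exact hy
      have := h _ (hsub hy')
      rw [refPoly_apply] at this
      simpa using this
  have : polyOfCoord d q a = 0 := Subtype.ext hz
  simpa using this

/-- Equivalence of norms on the finite dimensional space of polynomials: the `L_2`-norm on a small
ball controls the coordinates. -/
lemma exists_coercive_refPoly (d q : ℕ) : ∃ c : ℝ, 0 < c ∧ ∀ a : Fin (polyDim d q) → ℝ,
    c * ‖a‖ ^ 2 ≤ ∫ y in Metric.ball (0 : E d) (1 / 4), refPoly q y a ^ 2 := by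
  set B : Set (E d) := Metric.ball 0 (1 / 4)
  have hint : ∀ a b : Fin (polyDim d q) → ℝ,
      IntegrableOn (fun y : E d => refPoly q y a * refPoly q y b) B := fun a b =>
    ((((contDiff_refPoly a).continuous.mul (contDiff_refPoly b).continuous).continuousOn
      ).integrableOn_compact (isCompact_closedBall (0 : E d) (1 / 4))).mono_set
      Metric.ball_subset_closedBall
  set Q : (Fin (polyDim d q) → ℝ) → ℝ := fun a => ∫ y in B, refPoly q y a ^ 2
  have hQ : Q = fun a => ∑ i, ∑ j, a i * a j *
      ∫ y in B, refPoly q y (Pi.single i 1) * refPoly q y (Pi.single j 1) := by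
    ext a
    have : ∀ y : E d, refPoly q y a ^ 2 = ∑ i, ∑ j, a i * a j *
        (refPoly q y (Pi.single i 1) * refPoly q y (Pi.single j 1)) := fun y => by
      rw [refPoly_eq_sum, sq, Finset.sum_mul_sum]
      exact Finset.sum_congr rfl fun i _ => Finset.sum_congr rfl fun j _ => by ring
    simp only [Q, this]
    rw [integral_finsetSum _ fun i _ =>
      integrable_finsetSum _ fun j _ => (hint _ _).const_mul _]
    refine Finset.sum_congr rfl fun i _ => ?_
    rw [integral_finsetSum _ fun j _ => (hint _ _).const_mul _]
    exact Finset.sum_congr rfl fun j _ => integral_const_mul _ _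
  have hcont : Continuous Q := by rw [hQ]; fun_prop
  have hpos : ∀ a, a ≠ 0 → 0 < Q a := fun a ha => by
    refine lt_of_le_of_ne (integral_nonneg fun y => sq_nonneg _) fun h0 => ha ?_
    refine eq_zero_of_refPoly_eq_zero (by norm_num : (0 : ℝ) < 1 / 4) a fun y hy => ?_
    have h1 := (setIntegral_eq_zero_iff_of_nonneg_ae (μ := volume) (s := B)
      (f := fun y : E d => refPoly q y a ^ 2) (Filter.Eventually.of_forall fun y => sq_nonneg _)
      (by simpa only [sq] using hint a a)).1 h0.symm
    have h2 := Measure.eqOn_open_of_ae_eq (μ := (volume : Measure (E d))) h1 Metric.isOpen_ball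
      ((contDiff_refPoly a).continuous.pow 2).continuousOn continuousOn_const
    simpa using h2 hy
  have hhom : ∀ (t : ℝ) a, Q (t • a) = t ^ 2 * Q a := fun t a => by
    simp only [Q, map_smul, smul_eq_mul, mul_pow]
    exact integral_const_mul _ _
  rcases subsingleton_or_nontrivial (Fin (polyDim d q) → ℝ) with hs | hs
  · refine ⟨1, one_pos, fun a => ?_⟩
    rw [Subsingleton.elim a 0]
    simp
  obtain ⟨a₀, ha₀, hmin⟩ := (isCompact_sphere (0 : Fin (polyDim d q) → ℝ) 1).exists_isMinOn
    ((NormedSpace.sphere_nonempty (E := Fin (polyDim d q) → ℝ)).2 zero_le_one)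
    hcont.continuousOn
  have ha₀' : a₀ ≠ 0 := by
    rintro rfl; simp at ha₀
  refine ⟨Q a₀, hpos a₀ ha₀', fun a => ?_⟩
  rcases eq_or_ne a 0 with rfl | ha
  · simp
  have hn : ‖a‖ ≠ 0 := norm_ne_zero_iff.2 ha
  have := hmin (a := ‖a‖⁻¹ • a) (by simp [norm_smul, hn])
  change Q a₀ ≤ Q _ at this
  rw [hhom] at this
  calc Q a₀ * ‖a‖ ^ 2 ≤ (‖a‖⁻¹ ^ 2 * Q a) * ‖a‖ ^ 2 := by gcongr
    _ = Q a := by field_simp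

lemma exists_refPoly_le (d q : ℕ) (R : ℝ) : ∃ M : ℝ, 0 < M ∧
    ∀ (a : Fin (polyDim d q) → ℝ) (y : E d), ‖y‖ ≤ R → |refPoly q y a| ≤ M * ‖a‖ := by
  have h : ∀ i : Fin (polyDim d q), ∃ C : ℝ, ∀ y ∈ Metric.closedBall (0 : E d) R,
      ‖refPoly q y (Pi.single i 1)‖ ≤ C := fun i =>
    (isCompact_closedBall (0 : E d) R).exists_bound_of_continuousOn
      (contDiff_refPoly _).continuous.continuousOn
  choose C hC using h
  refine ⟨∑ i, |C i| + 1, by positivity, fun a y hy => ?_⟩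
  rw [refPoly_eq_sum]
  refine (Finset.abs_sum_le_sum_abs _ _).trans ?_
  rw [add_mul, Finset.sum_mul]
  refine le_add_of_le_of_nonneg (Finset.sum_le_sum fun i _ => ?_) (by positivity)
  rw [abs_mul, mul_comm]
  exact mul_le_mul ((hC i y (by simpa using hy)).trans (le_abs_self _)) (norm_le_pi_norm a i)
    (abs_nonneg _) (abs_nonneg _)

/-- A smooth cutoff function, equal to `1` on the ball of radius `1 / 4` and supported in the ball
of radius `1 / 2`. -/
def cutoff (d : ℕ) : ContDiffBump (0 : E d) := ⟨1 / 4, 1 / 2, by norm_num, by norm_num⟩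

lemma exists_lipschitz_cutoff_mul_refPoly (d q : ℕ) : ∃ L : ℝ, 0 < L ∧
    ∀ (a : Fin (polyDim d q) → ℝ) (y z : E d),
      |cutoff d y * refPoly q y a - cutoff d z * refPoly q z a| ≤ L * ‖a‖ * ‖y - z‖ := by
  have h : ∀ i : Fin (polyDim d q), ∃ C : ℝ≥0, LipschitzWith C
      fun y : E d => cutoff d y * refPoly q y (Pi.single i 1) := fun i =>
    ContDiff.lipschitzWith_of_hasCompactSupport (𝕂 := ℝ) (n := ∞)
      ((cutoff d).hasCompactSupport.mul_right) ((cutoff d).contDiff.mul (contDiff_refPoly _))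
      (by simp)
  choose C hC using h
  refine ⟨∑ i, (C i : ℝ) + 1, by positivity, fun a y z => ?_⟩
  have : cutoff d y * refPoly q y a - cutoff d z * refPoly q z a =
      ∑ i, a i * (cutoff d y * refPoly q y (Pi.single i 1) -
        cutoff d z * refPoly q z (Pi.single i 1)) := by
    rw [refPoly_eq_sum y, refPoly_eq_sum z, Finset.mul_sum, Finset.mul_sum,
      ← Finset.sum_sub_distrib]
    exact Finset.sum_congr rfl fun i _ => by ring
  rw [this]
  refine (Finset.abs_sum_le_sum_abs _ _).trans ?_
  rw [add_mul, add_mul, Finset.sum_mul, Finset.sum_mul]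
  refine le_add_of_le_of_nonneg (Finset.sum_le_sum fun i _ => ?_) (by positivity)
  rw [abs_mul, mul_comm (C i : ℝ), mul_assoc]
  gcongr
  · exact norm_le_pi_norm a i
  · simpa [Real.dist_eq, dist_eq_norm] using (hC i).dist_le_mul y z

end

section

variable {d : ℕ} {Ω : Set (E d)}

/-! ### Lipschitz functions on finite closed covers -/

/-- A function that is Lipschitz on each member of a finite closed cover of a normed space is
Lipschitz: along a segment, points arbitrarily close to the right of `t` belong to one and the
same member of the cover, which then contains the point at `t` too. -/
lemma lipschitzWith_of_finite_closed_cover {X ι : Type*} [NormedAddCommGroup X]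
    [NormedSpace ℝ X] [Finite ι] {s : ι → Set X} (hs : ∀ i, IsClosed (s i))
    (hcov : ⋃ i, s i = Set.univ) {f : X → ℝ} {L : ℝ≥0} (hf : ∀ i, LipschitzOnWith L f (s i)) :
    LipschitzWith L f := by
  have hcont : Continuous f :=
    (locallyFinite_of_finite s).continuous hcov hs fun i => (hf i).continuousOn
  refine LipschitzWith.of_dist_le_mul fun y x => ?_
  set γ : ℝ → X := fun t => AffineMap.lineMap x y t
  have hγ : Continuous γ := AffineMap.lineMap_continuous
  have hγd : ∀ t u, dist (γ t) (γ u) = |t - u| * dist y x := fun t u => by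
    simp only [γ]
    rw [dist_lineMap_lineMap, Real.dist_eq, dist_comm x y]
  have key : Set.Icc (0 : ℝ) 1 ⊆ {t | dist (f (γ t)) (f x) ≤ L * (t * dist y x)} := by
    refine IsClosed.Icc_subset_of_forall_exists_gt ?_ (by simp [γ]) ?_
    · exact (isClosed_le ((hcont.comp hγ).dist continuous_const) (by fun_prop)).inter
        isClosed_Icc
    · rintro t ⟨ht, ht0, ht1⟩ u hu
      obtain ⟨i, hi⟩ : ∃ i, ∃ᶠ t' in nhdsWithin t (Set.Ioi t), γ t' ∈ s i := by
        by_contra! h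
        obtain ⟨t', ht'⟩ := (Filter.eventually_all.2 h).exists
        have : γ t' ∈ ⋃ i, s i := by rw [hcov]; trivial
        simp only [Set.mem_iUnion] at this
        exact this.elim ht'
      have hti : γ t ∈ s i := by
        have := mem_closure_of_frequently_of_tendsto hi
          ((hγ.tendsto t).mono_left nhdsWithin_le_nhds)
        rwa [(hs i).closure_eq] at this
      obtain ⟨t', ht'i, ht'⟩ := (hi.and_eventually (Ioc_mem_nhdsGT hu)).exists
      refine ⟨t', ?_, ht'⟩
      calc dist (f (γ t')) (f x) ≤ dist (f (γ t')) (f (γ t)) + dist (f (γ t)) (f x) :=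
            dist_triangle _ _ _
        _ ≤ L * dist (γ t') (γ t) + L * (t * dist y x) :=
            add_le_add ((hf i).dist_le_mul _ ht'i _ hti) ht
        _ = L * (t' * dist y x) := by
            rw [hγd, abs_of_pos (sub_pos.2 ht'.1)]; ring
  simpa [γ] using key (Set.right_mem_Icc.2 zero_le_one)

/-! ### Simplices and affine functions -/

lemma isCompact_hull (T : Finset (E d)) : IsCompact (hull T) :=
  Set.Finite.isCompact_convexHull ℝ T.finite_toSet

lemma convex_hull (T : Finset (E d)) : Convex ℝ (hull T) := convex_convexHull ℝ _

lemma abs_affine_sub_le {S : Set (E d)} (A : E d →ᴬ[ℝ] ℝ) {k ε : ℝ}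
    (h : ∀ v ∈ S, |A v - k| ≤ ε) {x : E d} (hx : x ∈ convexHull ℝ S) : |A x - k| ≤ ε := by
  have hc : Convex ℝ (A ⁻¹' Metric.closedBall k ε) :=
    (convex_closedBall k ε).affine_preimage A.toAffineMap
  exact convexHull_min (t := A ⁻¹' Metric.closedBall k ε) (fun v hv => h v hv) hc hx

lemma affine_eq_of_eq_on_vertices {S : Set (E d)} (A B : E d →ᴬ[ℝ] ℝ)
    (h : ∀ v ∈ S, A v = B v) {x : E d} (hx : x ∈ convexHull ℝ S) : A x = B x := by
  have := abs_affine_sub_le (A - B) (k := 0) (ε := 0) (S := S) (fun v hv => by simp [h v hv]) hx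
  simpa [sub_eq_zero] using this

lemma exists_affine_eq_on_vertices {T : Finset (E d)} (hT : T.card = d + 1)
    (hi : AffineIndependent ℝ ((↑) : T → E d)) (c : E d → ℝ) :
    ∃ A : E d →ᴬ[ℝ] ℝ, ∀ v ∈ T, A v = c v := by
  classical
  have htop : affineSpan ℝ (Set.range ((↑) : T → E d)) = ⊤ := by
    rw [hi.affineSpan_eq_top_iff_card_eq_finrank_add_one]
    simp [hT]
  let b : AffineBasis T ℝ (E d) := ⟨_, hi, htop⟩
  let A : E d →ᵃ[ℝ] ℝ := ∑ v : T, c v • b.coord v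
  refine ⟨⟨A, A.continuous_of_finiteDimensional⟩, fun v hv => ?_⟩
  have hsum : ∀ x, A x = ∑ v : T, c v * b.coord v x := fun x => by
    simp only [A]
    induction (Finset.univ : Finset T) using Finset.induction_on with
    | empty => simp
    | insert a s ha ih => simp [Finset.sum_insert ha, ih]
  change A v = c v
  have h1 : ∀ u : T, b.coord u v = if u = ⟨v, hv⟩ then 1 else 0 := fun u =>
    b.coord_apply u ⟨v, hv⟩
  rw [hsum]
  simp [h1]

lemma exists_polynomial_eq_affine (A : E d →ᴬ[ℝ] ℝ) :
    ∃ p : MvPolynomial (Fin d) ℝ, p.totalDegree ≤ 1 ∧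
      ∀ x : E d, A x = MvPolynomial.eval (fun i => x i) p := by
  refine ⟨MvPolynomial.C (A 0) + ∑ i, MvPolynomial.C (A.contLinear (EuclideanSpace.single i 1)) *
    MvPolynomial.X i, ?_, fun x => ?_⟩
  · refine (MvPolynomial.totalDegree_add _ _).trans (max_le (by simp) ?_)
    refine MvPolynomial.totalDegree_finsetSum_le fun i _ => ?_
    refine (MvPolynomial.totalDegree_mul _ _).trans ?_
    simp
  · have hx : x = ∑ i, x i • EuclideanSpace.single i (1 : ℝ) := by
      simpa using ((EuclideanSpace.basisFun (Fin d) ℝ).sum_repr x).symm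
    have h1 := congrFun A.decomp x
    simp only [Pi.add_apply, Function.const_apply] at h1
    have h2 : A.contLinear x = ∑ i, x i * A.contLinear (EuclideanSpace.single i 1) := by
      conv_lhs => rw [hx]
      simp [map_sum]
    rw [h1, h2, add_comm]
    simp [mul_comm]

/-! ### Conforming meshes -/

namespace ConformingMesh

variable (𝒯 : ConformingMesh Ω)

/-- In a conforming mesh no element meets the interior of a different one: the affine function
that is `1` at a vertex of `U` outside `T` and `0` at the other vertices of `U` is nonnegative
on `U` and vanishes on `T ∩ U`. -/
lemma disjoint_interior {T U : Finset (E d)} (hT : T ∈ 𝒯.elems) (hU : U ∈ 𝒯.elems)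
    (hne : T ≠ U) {x : E d} (hxT : x ∈ hull T) : x ∉ interior (hull U) := by
  classical
  intro hxU
  obtain ⟨u, huU, huT⟩ : ∃ u ∈ U, u ∉ T := by
    by_contra! h
    exact hne (Finset.eq_of_subset_of_card_le h
      (by rw [𝒯.card_eq T hT, 𝒯.card_eq U hU])).symm
  obtain ⟨A, hA⟩ := exists_affine_eq_on_vertices (𝒯.card_eq U hU) (𝒯.indep U hU)
    (fun v => if v = u then 1 else 0)
  have hAx : A x = 0 := by
    have hx : x ∈ convexHull ℝ ((T : Set (E d)) ∩ (U : Set (E d))) := by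
      rw [← 𝒯.inter_eq T hT U hU]
      exact ⟨hxT, _root_.interior_subset hxU⟩
    have := abs_affine_sub_le A (k := 0) (ε := 0) (fun v hv => by
      have hv' : v ≠ u := by rintro rfl; exact huT hv.1
      rw [hA v hv.2, if_neg hv']; simp) hx
    simpa using this
  have hpos : ∀ y ∈ hull U, 0 ≤ A y := fun y hy => by
    have := abs_affine_sub_le A (k := 1 / 2) (ε := 1 / 2) (fun v hv => by
      rw [hA v hv]; split_ifs <;> norm_num [abs_le]) hy
    linarith [(abs_le.1 this).1]
  have hAu : A u = 1 := by rw [hA u huU, if_pos rfl]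
  have hcont : Filter.Tendsto (fun t : ℝ => AffineMap.lineMap x u t) (nhds 0) (nhds x) := by
    have : Continuous fun t : ℝ => AffineMap.lineMap x u t := AffineMap.lineMap_continuous
    simpa using this.tendsto 0
  have hev := hcont.eventually (mem_interior_iff_mem_nhds.1 hxU)
  obtain ⟨ε, hε, hball⟩ := Metric.eventually_nhds_iff.1 hev
  -- Moving from `x` away from `u` stays inside `U` but makes `A` negative.
  have h1 : 0 ≤ A (AffineMap.lineMap x u (-(ε / 2))) :=
    hpos _ (hball (by simp [abs_of_pos hε]; linarith))
  have h2 : A (AffineMap.lineMap x u (-(ε / 2))) = AffineMap.lineMap (A x) (A u) (-(ε / 2)) :=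
    A.toAffineMap.apply_lineMap x u _
  rw [h2, hAx, hAu] at h1
  simp [AffineMap.lineMap_apply] at h1
  linarith

lemma eq_of_mem_interior {T U : Finset (E d)} (hT : T ∈ 𝒯.elems) (hU : U ∈ 𝒯.elems)
    {x : E d} (hxT : x ∈ hull T) (hxU : x ∈ interior (hull U)) : T = U := by
  by_contra h
  exact 𝒯.disjoint_interior hT hU h hxT hxU

lemma exists_mem_hull {x : E d} (hx : x ∈ closure Ω) : ∃ T ∈ 𝒯.elems, x ∈ hull T := by
  rw [← 𝒯.cover] at hx
  simpa using hx

lemma hull_subset_closure {T : Finset (E d)} (hT : T ∈ 𝒯.elems) : hull T ⊆ closure Ω := by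
  rw [← 𝒯.cover]
  exact Set.subset_biUnion_of_mem (u := hull) hT

lemma isCompact_closure (𝒯 : ConformingMesh Ω) : IsCompact (closure Ω) := by
  rw [← 𝒯.cover]
  exact 𝒯.elems.isCompact_biUnion fun T _ => isCompact_hull T

lemma volume_lt_top (𝒯 : ConformingMesh Ω) : volume Ω < ⊤ :=
  (measure_mono subset_closure).trans_lt 𝒯.isCompact_closure.measure_lt_top

lemma ae_mem_interior : ∀ᵐ x ∂(volume.restrict Ω), ∃ T ∈ 𝒯.elems, x ∈ interior (hull T) := by
  have h0 : ∀ᵐ x ∂(volume : Measure (E d)), ∀ T ∈ 𝒯.elems, x ∉ frontier (hull T) := by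
    rw [Filter.eventually_all_finset]
    intro T _
    exact measure_eq_zero_iff_ae_notMem.1 ((convex_hull T).addHaar_frontier volume)
  have hm : ∀ᵐ x ∂(volume.restrict Ω), x ∈ closure Ω :=
    ae_restrict_of_ae_restrict_of_subset subset_closure
      (ae_restrict_mem isClosed_closure.measurableSet)
  filter_upwards [ae_restrict_of_ae h0, hm] with x hx hxΩ
  obtain ⟨T, hT, hxT⟩ := 𝒯.exists_mem_hull hxΩ
  refine ⟨T, hT, ?_⟩
  by_contra h
  exact hx T hT ⟨subset_closure hxT, h⟩

lemma restrict_hull {T : Finset (E d)} (hT : T ∈ 𝒯.elems) :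
    (volume.restrict Ω).restrict (hull T) = volume.restrict (interior (hull T)) := by
  rw [Measure.restrict_restrict (isCompact_hull T).isClosed.measurableSet]
  refine Measure.restrict_congr_set (Filter.EventuallyLE.antisymm ?_ ?_)
  · exact Filter.EventuallyLE.trans Set.inter_subset_left.eventuallyLE
      (interior_ae_eq_of_null_frontier ((convex_hull T).addHaar_frontier volume)).symm.le
  · exact (Set.subset_inter _root_.interior_subset (𝒯.interior_subset T hT)).eventuallyLE

end ConformingMesh

/-! ### Piecewise affine interpolation -/

/-- The affine function with the values `c` at the vertices `T` of a nondegenerate simplex. (It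
is `0` if there is no such function.) -/
def vertexInterp (T : Finset (E d)) (c : E d → ℝ) : E d →ᴬ[ℝ] ℝ :=
  open Classical in if h : ∃ A : E d →ᴬ[ℝ] ℝ, ∀ v ∈ T, A v = c v then h.choose else 0

namespace ConformingMesh

/-- The continuous piecewise affine interpolant on the closure of `Ω` of the values of `c` at the
vertices of the mesh, extended by zero. On the intersection of several elements it does not matter
which of them is chosen, see `interp_eq`. -/
def interp (𝒯 : ConformingMesh Ω) (c : E d → ℝ) (x : E d) : ℝ :=
  open Classical in if h : ∃ T ∈ 𝒯.elems, x ∈ hull T then vertexInterp h.choose c x else 0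

variable (𝒯 : ConformingMesh Ω)

lemma vertexInterp_apply {T : Finset (E d)} (hT : T ∈ 𝒯.elems) (c : E d → ℝ) {v : E d}
    (hv : v ∈ T) : vertexInterp T c v = c v := by
  have h := exists_affine_eq_on_vertices (𝒯.card_eq T hT) (𝒯.indep T hT) c
  rw [vertexInterp, dif_pos h]
  exact h.choose_spec v hv

lemma interp_eq {T : Finset (E d)} (hT : T ∈ 𝒯.elems) (c : E d → ℝ) {x : E d}
    (hx : x ∈ hull T) : 𝒯.interp c x = vertexInterp T c x := by
  have h : ∃ T ∈ 𝒯.elems, x ∈ hull T := ⟨T, hT, hx⟩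
  rw [interp, dif_pos h]
  obtain ⟨hU, hxU⟩ := h.choose_spec
  refine affine_eq_of_eq_on_vertices (S := (h.choose : Set (E d)) ∩ T) _ _ (fun v hv => ?_) ?_
  · rw [𝒯.vertexInterp_apply hU c hv.1, 𝒯.vertexInterp_apply hT c hv.2]
  · rw [← 𝒯.inter_eq _ hU _ hT]
    exact ⟨hxU, hx⟩

lemma interp_of_forall_notMem (c : E d → ℝ) {x : E d} (hx : ¬∃ T ∈ 𝒯.elems, x ∈ hull T) :
    𝒯.interp c x = 0 := by
  rw [interp, dif_neg hx]

lemma abs_interp_sub_le {T : Finset (E d)} (hT : T ∈ 𝒯.elems) (c : E d → ℝ) {x : E d}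
    (hx : x ∈ hull T) {k ε : ℝ} (h : ∀ v ∈ T, |c v - k| ≤ ε) : |𝒯.interp c x - k| ≤ ε := by
  rw [𝒯.interp_eq hT c hx]
  exact abs_affine_sub_le _ (fun v hv => by rw [𝒯.vertexInterp_apply hT c hv]; exact h v hv) hx

lemma abs_interp_le (c : E d → ℝ) {K : ℝ} (h : ∀ v, |c v| ≤ K) (x : E d) :
    |𝒯.interp c x| ≤ K := by
  by_cases hx : ∃ T ∈ 𝒯.elems, x ∈ hull T
  · obtain ⟨T, hT, hxT⟩ := hx
    simpa using 𝒯.abs_interp_sub_le hT c hxT (k := 0) (ε := K) (fun v _ => by simpa using h v)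
  · rw [𝒯.interp_of_forall_notMem c hx, abs_zero]
    exact (abs_nonneg _).trans (h x)

lemma exists_vertex_ne_zero_of_interp_ne_zero {c : E d → ℝ} {x : E d}
    (hx : 𝒯.interp c x ≠ 0) : ∃ T ∈ 𝒯.elems, x ∈ hull T ∧ ∃ v ∈ T, c v ≠ 0 := by
  by_cases h : ∃ T ∈ 𝒯.elems, x ∈ hull T
  · obtain ⟨T, hT, hxT⟩ := h
    refine ⟨T, hT, hxT, ?_⟩
    by_contra! h0
    have := 𝒯.abs_interp_sub_le hT c hxT (k := 0) (ε := 0) fun v hv => by simp [h0 v hv]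
    exact hx (by simpa using this)
  · exact absurd (𝒯.interp_of_forall_notMem c h) hx

lemma interp_add (c c' : E d → ℝ) (x : E d) :
    𝒯.interp (c + c') x = 𝒯.interp c x + 𝒯.interp c' x := by
  by_cases h : ∃ T ∈ 𝒯.elems, x ∈ hull T
  · obtain ⟨T, hT, hxT⟩ := h
    simp only [𝒯.interp_eq hT _ hxT]
    rw [← ContinuousAffineMap.add_apply]
    refine affine_eq_of_eq_on_vertices _ _ (fun v hv => ?_) hxT
    simp [𝒯.vertexInterp_apply hT _ hv]
  · simp [𝒯.interp_of_forall_notMem _ h]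

lemma interp_smul (t : ℝ) (c : E d → ℝ) (x : E d) :
    𝒯.interp (t • c) x = t * 𝒯.interp c x := by
  by_cases h : ∃ T ∈ 𝒯.elems, x ∈ hull T
  · obtain ⟨T, hT, hxT⟩ := h
    simp only [𝒯.interp_eq hT _ hxT]
    rw [← smul_eq_mul, ← ContinuousAffineMap.smul_apply]
    refine affine_eq_of_eq_on_vertices _ _ (fun v hv => ?_) hxT
    simp [𝒯.vertexInterp_apply hT _ hv]
  · simp [𝒯.interp_of_forall_notMem _ h]

/-- Interpolation as a linear map. -/
def interpₗ : (E d → ℝ) →ₗ[ℝ] (E d → ℝ) where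
  toFun := 𝒯.interp
  map_add' c c' := funext fun x => 𝒯.interp_add c c' x
  map_smul' t c := funext fun x => 𝒯.interp_smul t c x

/-- An interpolant that vanishes outside `Ω` is Lipschitz. -/
lemma exists_lipschitzWith_interp (hΩ : IsOpen Ω) {c : E d → ℝ}
    (h0 : ∀ x ∉ Ω, 𝒯.interp c x = 0) : ∃ L : ℝ≥0, LipschitzWith L (𝒯.interp c) := by
  classical
  let s : Option 𝒯.elems → Set (E d) := fun o => o.elim Ωᶜ fun T => hull T
  refine ⟨∑ T ∈ 𝒯.elems, ‖(vertexInterp T c).contLinear‖₊,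
    lipschitzWith_of_finite_closed_cover (s := s) ?_ ?_ ?_⟩
  · rintro (_ | T)
    · exact hΩ.isClosed_compl
    · exact (isCompact_hull _).isClosed
  · refine Set.eq_univ_of_forall fun x => Set.mem_iUnion.2 ?_
    by_cases hx : x ∈ Ω
    · obtain ⟨T, hT, hxT⟩ := 𝒯.exists_mem_hull (subset_closure hx)
      exact ⟨some ⟨T, hT⟩, hxT⟩
    · exact ⟨none, hx⟩
  · rintro (_ | ⟨T, hT⟩)
    · refine LipschitzOnWith.of_dist_le_mul fun x hx y hy => ?_
      rw [h0 x hx, h0 y hy, dist_self]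
      positivity
    · refine LipschitzOnWith.of_dist_le_mul fun x hx y hy => ?_
      rw [𝒯.interp_eq hT c hx, 𝒯.interp_eq hT c hy]
      have h1 := congrFun (vertexInterp T c).decomp x
      have h2 := congrFun (vertexInterp T c).decomp y
      simp only [Pi.add_apply, Function.const_apply] at h1 h2
      rw [h1, h2, dist_add_right, dist_eq_norm, dist_eq_norm, ← map_sub]
      refine (ContinuousLinearMap.le_opNorm _ _).trans ?_
      gcongr
      rw [← coe_nnnorm, NNReal.coe_le_coe]
      exact Finset.single_le_sum (f := fun T => ‖(vertexInterp T c).contLinear‖₊)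
        (fun _ _ => zero_le) hT

end ConformingMesh

end

section

variable {d : ℕ} {Ω : Set (E d)}

/-! ### Mollification of Lipschitz functions -/

/-- The convolution of `v` with a smooth bump function supported in the ball of radius
`1 / (n + 1)`. -/
def mollify (v : E d → ℝ) (n : ℕ) : E d → ℝ :=
  MeasureTheory.convolution ((⟨1 / (n + 1) / 2, 1 / (n + 1), by positivity,
    half_lt_self (by positivity)⟩ : ContDiffBump (0 : E d)).normed volume) v
    (ContinuousLinearMap.lsmul ℝ ℝ) volume

/-- The convolution kernel of `mollify`, with the properties that matter. -/
lemma exists_kernel_mollify (d n : ℕ) : ∃ ρ : E d → ℝ, ContDiff ℝ ∞ ρ ∧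
    HasCompactSupport ρ ∧ (∀ x, 0 ≤ ρ x) ∧ ∫ x, ρ x = 1 ∧
    Function.support ρ = Metric.ball 0 (1 / (n + 1)) ∧
    ∀ v : E d → ℝ, mollify v n = MeasureTheory.convolution ρ v
      (ContinuousLinearMap.lsmul ℝ ℝ) volume := by
  set ψ : ContDiffBump (0 : E d) := ⟨1 / (n + 1) / 2, 1 / (n + 1), by positivity,
    half_lt_self (by positivity)⟩
  exact ⟨ψ.normed volume, ψ.contDiff_normed, ψ.hasCompactSupport_normed, ψ.nonneg_normed,
    ψ.integral_normed, ψ.support_normed_eq, fun v => rfl⟩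

section

variable {v : E d → ℝ}

lemma mollify_eq_integral {n : ℕ} {ρ : E d → ℝ} (h : mollify v n =
    MeasureTheory.convolution ρ v (ContinuousLinearMap.lsmul ℝ ℝ) volume) (x : E d) :
    mollify v n x = ∫ t, ρ t * v (x - t) := by
  rw [h]; rfl

lemma contDiff_mollify (hv : Continuous v) (n : ℕ) : ContDiff ℝ ∞ (mollify v n) := by
  obtain ⟨ρ, hρ, hρc, -, -, -, h⟩ := exists_kernel_mollify d n
  rw [h]
  exact hρc.contDiff_convolution_left _ hρ hv.locallyIntegrable

lemma abs_sub_mollify_le {L : ℝ≥0} (hv : LipschitzWith L v) (n : ℕ) (x : E d) :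
    |v x - mollify v n x| ≤ L * (1 / (n + 1)) := by
  obtain ⟨ρ, hρ, hρc, hρ0, hρ1, hρs, h⟩ := exists_kernel_mollify d n
  have hi : ∀ k : E d → ℝ, Continuous k → Integrable fun t => ρ t * k t := fun k hk =>
    (hρ.continuous.mul hk).integrable_of_hasCompactSupport hρc.mul_right
  rw [mollify_eq_integral (h v)]
  have h1 : v x = ∫ t, ρ t * v x := by rw [integral_mul_const, hρ1, one_mul]
  rw [h1, ← integral_sub (hi _ continuous_const)
    (hi (fun t => v (x - t)) (hv.continuous.comp (by fun_prop)))]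
  have h2 : (L : ℝ) * (1 / (n + 1)) = ∫ t, ρ t * (L * (1 / (n + 1))) := by
    rw [integral_mul_const, hρ1, one_mul]
  rw [h2, ← Real.norm_eq_abs]
  refine norm_integral_le_of_norm_le (hi _ continuous_const)
    (Filter.Eventually.of_forall fun t => ?_)
  rw [← mul_sub, norm_mul, Real.norm_of_nonneg (hρ0 t)]
  by_cases ht : ρ t = 0
  · simp [ht]
  · have : t ∈ Metric.ball (0 : E d) (1 / (n + 1)) := by rw [← hρs]; exact ht
    rw [mem_ball_zero_iff] at this
    refine mul_le_mul_of_nonneg_left ?_ (hρ0 t)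
    rw [← dist_eq_norm]
    refine (hv.dist_le_mul _ _).trans ?_
    rw [dist_eq_norm, sub_sub_cancel]
    gcongr

lemma lipschitzWith_mollify {L : ℝ≥0} (hv : LipschitzWith L v) (n : ℕ) :
    LipschitzWith L (mollify v n) := by
  obtain ⟨ρ, hρ, hρc, hρ0, hρ1, hρs, h⟩ := exists_kernel_mollify d n
  have hi : ∀ k : E d → ℝ, Continuous k → Integrable fun t => ρ t * k t := fun k hk =>
    (hρ.continuous.mul hk).integrable_of_hasCompactSupport hρc.mul_right
  refine LipschitzWith.of_dist_le_mul fun x y => ?_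
  rw [mollify_eq_integral (h v), mollify_eq_integral (h v), dist_eq_norm,
    ← integral_sub (hi (fun t => v (x - t)) (hv.continuous.comp (by fun_prop)))
      (hi (fun t => v (y - t)) (hv.continuous.comp (by fun_prop)))]
  have h2 : (L : ℝ) * dist x y = ∫ t, ρ t * (L * dist x y) := by
    rw [integral_mul_const, hρ1, one_mul]
  rw [h2]
  refine norm_integral_le_of_norm_le (hi _ continuous_const)
    (Filter.Eventually.of_forall fun t => ?_)
  rw [← mul_sub, norm_mul, Real.norm_of_nonneg (hρ0 t)]
  refine mul_le_mul_of_nonneg_left ?_ (hρ0 t)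
  simpa [dist_eq_norm] using hv.dist_le_mul (x - t) (y - t)

lemma support_mollify_subset (n : ℕ) :
    Function.support (mollify v n) ⊆ Metric.cthickening (1 / (n + 1)) (tsupport v) := by
  obtain ⟨ρ, hρ, hρc, hρ0, hρ1, hρs, h⟩ := exists_kernel_mollify d n
  rw [h]
  refine (support_convolution_subset _).trans ?_
  rintro _ ⟨t, ht, y, hy, rfl⟩
  rw [hρs, mem_ball_zero_iff] at ht
  refine Metric.mem_cthickening_of_dist_le _ y _ _ (subset_tsupport _ hy) ?_
  simpa using ht.le

/-- Where `v` is locally affine, its mollifications eventually have the same derivative. -/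
lemma eventually_fderiv_mollify_eq {x : E d} {A : E d →ᴬ[ℝ] ℝ}
    (hA : v =ᶠ[nhds x] A) :
    ∀ᶠ n in Filter.atTop, fderiv ℝ (mollify v n) x = fderiv ℝ v x := by
  obtain ⟨ε, hε, hball⟩ := Metric.eventually_nhds_iff.1 hA
  have hlim : ∀ᶠ n : ℕ in Filter.atTop, (1 : ℝ) / (n + 1) < ε / 2 :=
    tendsto_one_div_add_atTop_nhds_zero_nat.eventually_lt_const (half_pos hε)
  filter_upwards [hlim] with n hn
  obtain ⟨ρ, hρ, hρc, hρ0, hρ1, hρs, h⟩ := exists_kernel_mollify d n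
  have hi : ∀ k : E d → ℝ, Continuous k → Integrable fun t => ρ t * k t := fun k hk =>
    (hρ.continuous.mul hk).integrable_of_hasCompactSupport hρc.mul_right
  have hdec : ∀ y, A y = A.contLinear y + A 0 := fun y => by
    simpa using congrFun A.decomp y
  have hloc : mollify v n =ᶠ[nhds x]
      fun y => A.contLinear y + (A 0 - ∫ t, ρ t * A.contLinear t) := by
    filter_upwards [Metric.ball_mem_nhds x (half_pos hε)] with y hy
    rw [mollify_eq_integral (h v)]
    have : ∀ t, ρ t * v (y - t) = ρ t * A y - ρ t * A.contLinear t := fun t => by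
      by_cases ht : ρ t = 0
      · simp [ht]
      · have ht' : t ∈ Metric.ball (0 : E d) (1 / (n + 1)) := by rw [← hρs]; exact ht
        rw [mem_ball_zero_iff] at ht'
        rw [Metric.mem_ball] at hy
        have hd : dist (y - t) x < ε := by
          have h3 := dist_triangle (y - t) y x
          have h4 : dist (y - t) y = ‖t‖ := by simp
          linarith
        rw [hball hd, hdec, hdec y, map_sub]
        ring
    simp only [this]
    rw [integral_sub (hi _ continuous_const) (hi _ A.contLinear.continuous), integral_mul_const,
      hρ1, hdec]
    ring
  have hv' : v =ᶠ[nhds x] fun y => A.contLinear y + A 0 := by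
    filter_upwards [hA] with y hy
    rw [hy, hdec]
  rw [hloc.fderiv_eq, hv'.fderiv_eq, fderiv_add_const, fderiv_add_const]

/-- A compactly supported Lipschitz function that is locally affine almost everywhere belongs to
`H^1_0`: its mollifications converge to it uniformly, and their gradients are bounded and converge
almost everywhere. -/
lemma mem_H10_of_lipschitz_of_locally_affine {L : ℝ≥0} (hΩ : IsOpen Ω) (hfin : volume Ω < ⊤)
    (hv : LipschitzWith L v) (hc : HasCompactSupport v) (hsub : tsupport v ⊆ Ω)
    (haff : ∀ᵐ x ∂(volume.restrict Ω), ∃ A : E d →ᴬ[ℝ] ℝ, v =ᶠ[nhds x] A)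
    {f : L2 Ω} (hf : f =ᵐ[volume.restrict Ω] v) : f ∈ H10 Ω := by
  have : IsFiniteMeasure (volume.restrict Ω) := ⟨by simpa using hfin⟩
  have hbd : ∀ {w : E d → ℝ}, LipschitzWith L w → ∀ (i : Fin d) (x : E d),
      ‖fderiv ℝ w x (EuclideanSpace.single i 1)‖ ≤ L := fun hw i x => by
    refine (ContinuousLinearMap.le_opNorm _ _).trans ?_
    simpa using norm_fderiv_le_of_lipschitz ℝ hw (x₀ := x)
  have hmem : ∀ i : Fin d, MemLp (fun x => fderiv ℝ v x (EuclideanSpace.single i 1)) 2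
      (volume.restrict Ω) := fun i =>
    MemLp.of_bound (measurable_fderiv_apply_const ℝ v _).aestronglyMeasurable L
      (Filter.Eventually.of_forall (hbd hv i))
  refine ⟨fun i => (hmem i).toLp _, fun ε hε => ?_⟩
  have hval : ∀ᶠ n in Filter.atTop, eLpNorm (fun x => f x - mollify v n x) 2
      (volume.restrict Ω) ≤ ε := by
    have hle : ∀ n, eLpNorm (fun x => f x - mollify v n x) 2 (volume.restrict Ω) ≤
        volume.restrict Ω Set.univ ^ (2 : ℝ≥0∞).toReal⁻¹ *
          ENNReal.ofReal (L * (1 / (n + 1))) := fun n => by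
      refine eLpNorm_le_of_ae_bound ?_
      filter_upwards [hf] with x hx
      rw [hx]
      exact abs_sub_mollify_le hv n x
    have h0 : Filter.Tendsto (fun n : ℕ => (L : ℝ) * (1 / (n + 1))) Filter.atTop (nhds 0) := by
      simpa using (tendsto_one_div_add_atTop_nhds_zero_nat (𝕜 := ℝ)).const_mul (L : ℝ)
    have h1 := ENNReal.Tendsto.const_mul
      (a := volume.restrict Ω Set.univ ^ (2 : ℝ≥0∞).toReal⁻¹) (ENNReal.tendsto_ofReal h0)
      (Or.inr (ENNReal.rpow_ne_top_of_nonneg (by simp) (measure_ne_top _ _)))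
    simp only [ENNReal.ofReal_zero, mul_zero] at h1
    filter_upwards [h1.eventually_lt_const (ENNReal.coe_pos.2 hε)] with n hn
    exact (hle n).trans hn.le
  have hgrad : ∀ i : Fin d, ∀ᶠ n in Filter.atTop, eLpNorm (fun x => (hmem i).toLp _ x -
      fderiv ℝ (mollify v n) x (EuclideanSpace.single i 1)) 2 (volume.restrict Ω) ≤ ε := fun i => by
    have hcongr : ∀ n, eLpNorm (fun x => (hmem i).toLp _ x -
        fderiv ℝ (mollify v n) x (EuclideanSpace.single i 1)) 2 (volume.restrict Ω) =
        (∫⁻ x in Ω, ‖fderiv ℝ v x (EuclideanSpace.single i 1) -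
          fderiv ℝ (mollify v n) x (EuclideanSpace.single i 1)‖ₑ ^ (2 : ℝ)) ^ (1 / 2 : ℝ) := by
      intro n
      rw [eLpNorm_congr_ae (g := fun x => fderiv ℝ v x (EuclideanSpace.single i 1) -
          fderiv ℝ (mollify v n) x (EuclideanSpace.single i 1)),
        eLpNorm_eq_lintegral_rpow_enorm_toReal (by simp) (by simp)]
      · simp
      · filter_upwards [(hmem i).coeFn_toLp] with x hx
        rw [hx]
    have hlim : Filter.Tendsto (fun n => ∫⁻ x in Ω, ‖fderiv ℝ v x (EuclideanSpace.single i 1) -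
        fderiv ℝ (mollify v n) x (EuclideanSpace.single i 1)‖ₑ ^ (2 : ℝ)) Filter.atTop
        (nhds (∫⁻ _ in Ω, 0)) := by
      refine tendsto_lintegral_of_dominated_convergence
        (fun _ => ENNReal.ofReal (L + L) ^ (2 : ℝ)) (fun n => ?_) (fun n => ?_) ?_ ?_
      · exact (((measurable_fderiv_apply_const ℝ v _).sub
          (measurable_fderiv_apply_const ℝ _ _)).enorm).pow_const _
      · refine Filter.Eventually.of_forall fun x => ?_
        refine ENNReal.rpow_le_rpow ?_ (by norm_num)
        rw [← ofReal_norm]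
        exact ENNReal.ofReal_le_ofReal ((norm_sub_le _ _).trans
          (add_le_add (hbd hv i x) (hbd (lipschitzWith_mollify hv n) i x)))
      · rw [lintegral_const]
        exact ENNReal.mul_ne_top (ENNReal.rpow_ne_top_of_nonneg (by norm_num) (by simp))
          (measure_ne_top _ _)
      · filter_upwards [haff] with x ⟨A, hA⟩
        refine tendsto_const_nhds.congr' ?_
        filter_upwards [eventually_fderiv_mollify_eq hA] with n hn
        rw [hn, sub_self]
        simp
    rw [lintegral_zero] at hlim
    have hlim2 := hlim.ennrpow_const (1 / 2 : ℝ)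
    rw [ENNReal.zero_rpow_of_pos (by norm_num)] at hlim2
    filter_upwards [hlim2.eventually_lt_const (ENNReal.coe_pos.2 hε)] with n hn
    rw [hcongr]
    exact hn.le
  obtain ⟨δ, hδ, hthick⟩ := hc.isCompact.exists_cthickening_subset_open hΩ hsub
  have hsmall : ∀ᶠ n : ℕ in Filter.atTop, (1 : ℝ) / (n + 1) < δ :=
    tendsto_one_div_add_atTop_nhds_zero_nat.eventually_lt_const hδ
  obtain ⟨n, hn1, hn2, hn3⟩ :=
    (hval.and ((Filter.eventually_all.2 hgrad).and hsmall)).exists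
  have hts : tsupport (mollify v n) ⊆ Metric.cthickening (1 / (n + 1)) (tsupport v) :=
    closure_minimal (support_mollify_subset n) Metric.isClosed_cthickening
  exact ⟨mollify v n, contDiff_mollify hv.continuous n,
    hc.isCompact.cthickening.of_isClosed_subset (isClosed_tsupport _) hts,
    hts.trans ((Metric.cthickening_mono hn3.le _).trans hthick), hn1, hn2⟩

end

end

/-! ### Biorthogonal projectors in a Hilbert space -/

section Hilbert

variable {H V : Type*} [NormedAddCommGroup H] [InnerProductSpace ℝ H]
  [NormedAddCommGroup V] [NormedSpace ℝ V] [FiniteDimensional ℝ V]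

/-- If the pairing of `Φ` and `Ψ` is coercive, every `w` has the same inner products with the range
of `Φ` as a unique element of the range of `Ψ`, which depends continuously on `w`. -/
lemma exists_solution_of_coercive (Φ Ψ : V →ₗ[ℝ] H) {c : ℝ} (hc : 0 < c)
    (h : ∀ a, c * ‖a‖ ^ 2 ≤ inner ℝ (Φ a) (Ψ a)) :
    ∃ α : H →L[ℝ] V, ∀ w a, inner ℝ (Φ a) (Ψ (α w)) = inner ℝ (Φ a) w := by
  let B : H →ₗ[ℝ] Module.Dual ℝ V :=
    { toFun := fun w => (innerₗ H w) ∘ₗ Φ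
      map_add' := fun w w' => by ext; simp
      map_smul' := fun t w => by ext; simp }
  have hB : ∀ w a, B w a = inner ℝ (Φ a) w := fun w a => real_inner_comm _ _
  have hinj : Function.Injective (B ∘ₗ Ψ) := by
    rw [← LinearMap.ker_eq_bot, LinearMap.ker_eq_bot']
    intro a ha
    have h1 : inner ℝ (Φ a) (Ψ a) = 0 := by
      rw [← hB]; exact DFunLike.congr_fun ha a
    have h2 := h a
    rw [h1] at h2
    have h3 : ‖a‖ ^ 2 ≤ 0 := nonpos_of_mul_nonpos_right h2 hc
    exact norm_eq_zero.1 (pow_eq_zero_iff two_ne_zero |>.1 (le_antisymm h3 (by positivity)))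
  let e : V ≃ₗ[ℝ] Module.Dual ℝ V :=
    LinearEquiv.ofInjectiveOfFinrankEq (B ∘ₗ Ψ) hinj Subspace.dual_finrank_eq.symm
  have he : ∀ a, e a = B (Ψ a) := fun a => rfl
  let α : H →ₗ[ℝ] V := e.symm.toLinearMap ∘ₗ B
  have hα : ∀ w a, inner ℝ (Φ a) (Ψ (α w)) = inner ℝ (Φ a) w := fun w a => by
    rw [← hB, ← hB, ← he]
    simp [α]
  have hbound : ∀ w, ‖α w‖ ≤ (‖LinearMap.toContinuousLinearMap Φ‖ / c) * ‖w‖ := fun w => by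
    have h1 := h (α w)
    rw [hα] at h1
    have h2 : inner ℝ (Φ (α w)) w ≤ ‖LinearMap.toContinuousLinearMap Φ‖ * ‖α w‖ * ‖w‖ :=
      (real_inner_le_norm _ _).trans (mul_le_mul_of_nonneg_right
        ((LinearMap.toContinuousLinearMap Φ).le_opNorm _) (norm_nonneg _))
    rcases (norm_nonneg (α w)).eq_or_lt with h0 | h0
    · rw [← h0]; positivity
    · rw [div_mul_eq_mul_div, le_div_iff₀ hc]
      refine le_of_mul_le_mul_right ?_ h0
      nlinarith
  exact ⟨α.mkContinuous _ hbound, hα⟩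

/-- A block diagonal pairing with coercive blocks gives rise to a projector onto the range of the
`Ψ k` whose adjoint is the identity on the range of the `Φ k`. -/
lemma exists_biorthogonal_projector [CompleteSpace H] {K : Type*} [Fintype K]
    (Φ Ψ : K → V →ₗ[ℝ] H) {c : K → ℝ} (hc : ∀ k, 0 < c k)
    (h : ∀ k a, c k * ‖a‖ ^ 2 ≤ inner ℝ (Φ k a) (Ψ k a))
    (horth : ∀ k l, k ≠ l → ∀ a b, inner ℝ (Φ k a) (Ψ l b) = 0) :
    ∃ (α : K → H →L[ℝ] V) (P : H →L[ℝ] H), (∀ w, P w = ∑ k, Ψ k (α k w)) ∧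
      IsIdempotentElem P ∧
      (∀ a : K → V, ∑ k, Φ k (a k) ∈ Set.range (ContinuousLinearMap.adjoint P)) ∧
      ∀ k w, c k * ‖α k w‖ ^ 2 ≤ inner ℝ (Φ k (α k w)) w := by
  classical
  choose α hα using fun k => exists_solution_of_coercive (Φ k) (Ψ k) (hc k) (h k)
  let P : H →L[ℝ] H := ∑ k, (LinearMap.toContinuousLinearMap (Ψ k)) ∘L α k
  have hP : ∀ w, P w = ∑ k, Ψ k (α k w) := fun w => by simp [P]
  have hΦP : ∀ k a w, inner ℝ (Φ k a) (P w) = inner ℝ (Φ k a) w := fun k a w => by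
    rw [hP, inner_sum, Finset.sum_eq_single k (fun l _ hl => horth k l hl.symm _ _) (by simp), hα]
  have huniq : ∀ k w w', (∀ a, inner ℝ (Φ k a) w = inner ℝ (Φ k a) w') → α k w = α k w' :=
    fun k w w' hw => by
      have h1 := h k (α k w - α k w')
      rw [map_sub (Ψ k), inner_sub_right, hα, hα, hw, sub_self] at h1
      have h3 : ‖α k w - α k w'‖ ^ 2 ≤ 0 := nonpos_of_mul_nonpos_right h1 (hc k)
      exact sub_eq_zero.1 (norm_eq_zero.1
        (pow_eq_zero_iff two_ne_zero |>.1 (le_antisymm h3 (by positivity))))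
  refine ⟨α, P, hP, ?_, fun a => ⟨∑ k, Φ k (a k), ?_⟩, fun k w => ?_⟩
  · ext1 w
    change P (P w) = P w
    rw [hP (P w), hP w]
    refine Finset.sum_congr rfl fun k _ => ?_
    rw [← hP, huniq k (P w) w fun a => hΦP k a w]
  · refine ext_inner_right ℝ fun w => ?_
    rw [ContinuousLinearMap.adjoint_inner_left, sum_inner, sum_inner]
    exact Finset.sum_congr rfl fun k _ => hΦP k _ w
  · rw [← hα k w]
    exact h k _

end Hilbert

/-- The linear map into `L_2(μ)` induced by a linear family of square integrable functions. -/
def toL2 {X V : Type*} [MeasurableSpace X] {μ : Measure X} [AddCommGroup V] [Module ℝ V]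
    (F : V →ₗ[ℝ] (X → ℝ)) (hF : ∀ a, MemLp (F a) 2 μ) : V →ₗ[ℝ] Lp ℝ 2 μ where
  toFun a := (hF a).toLp (F a)
  map_add' a b := by
    rw [← MemLp.toLp_add]
    exact MemLp.toLp_congr _ _ (by rw [map_add])
  map_smul' t a := by
    rw [RingHom.id_apply, ← MemLp.toLp_const_smul]
    exact MemLp.toLp_congr _ _ (by rw [map_smul])

lemma coeFn_toL2 {X V : Type*} [MeasurableSpace X] {μ : Measure X} [AddCommGroup V] [Module ℝ V]
    (F : V →ₗ[ℝ] (X → ℝ)) (hF : ∀ a, MemLp (F a) 2 μ) (a : V) : toL2 F hF a =ᵐ[μ] F a :=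
  (hF a).coeFn_toLp

section

variable {d q : ℕ} {Ω : Set (E d)}

/-! ### Local polynomials and bubbles on a coarse element -/

/-- `closedBall x₀ r` is an inscribed ball of the coarse element `T` that is comparable in size
to `T`, while the elements of `𝒮` inside `T` are smaller by the factor `η`. -/
structure IsReferenceBall (𝒮 : ConformingMesh Ω) (κ η : ℝ) (T : Finset (E d)) (x₀ : E d)
    (r : ℝ) : Prop where
  pos : 0 < r
  closedBall_subset : Metric.closedBall x₀ r ⊆ hull T
  subset_closedBall : hull T ⊆ Metric.closedBall x₀ (κ * r)
  diam_le : ∀ U ∈ 𝒮.elems, hull U ⊆ hull T → Metric.diam (hull U) ≤ η * r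

/-- The polynomial with coordinates `a` in the variable rescaled from `closedBall x₀ r` to the
unit ball. -/
def localPoly (q : ℕ) (x₀ : E d) (r : ℝ) : (Fin (polyDim d q) → ℝ) →ₗ[ℝ] (E d → ℝ) :=
  LinearMap.pi fun x => refPoly q (r⁻¹ • (x - x₀))

/-- The local polynomial multiplied by the rescaled cutoff function. -/
def localBubble (q : ℕ) (x₀ : E d) (r : ℝ) : (Fin (polyDim d q) → ℝ) →ₗ[ℝ] (E d → ℝ) :=
  LinearMap.pi fun x => cutoff d (r⁻¹ • (x - x₀)) • refPoly q (r⁻¹ • (x - x₀))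

/-- The restriction of the local polynomial to `S`, extended by zero. -/
def truncatedPoly (q : ℕ) (S : Set (E d)) (x₀ : E d) (r : ℝ) :
    (Fin (polyDim d q) → ℝ) →ₗ[ℝ] (E d → ℝ) :=
  LinearMap.pi fun x => S.indicator (fun _ => (1 : ℝ)) x • refPoly q (r⁻¹ • (x - x₀))

section

variable {x₀ : E d} {r : ℝ}

lemma localPoly_apply (a : Fin (polyDim d q) → ℝ) (x : E d) :
    localPoly q x₀ r a x = refPoly q (r⁻¹ • (x - x₀)) a := rfl

lemma localBubble_apply (a : Fin (polyDim d q) → ℝ) (x : E d) :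
    localBubble q x₀ r a x = cutoff d (r⁻¹ • (x - x₀)) * localPoly q x₀ r a x := rfl

lemma truncatedPoly_eq (S : Set (E d)) (a : Fin (polyDim d q) → ℝ) :
    truncatedPoly q S x₀ r a = S.indicator (localPoly q x₀ r a) := by
  ext x
  by_cases hx : x ∈ S <;> simp [truncatedPoly, localPoly_apply, hx]

lemma continuous_localPoly (a : Fin (polyDim d q) → ℝ) : Continuous (localPoly q x₀ r a) :=
  (contDiff_refPoly a).continuous.comp (g := fun y => refPoly q y a)
    (f := fun x => r⁻¹ • (x - x₀)) (by fun_prop)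

lemma continuous_localBubble (a : Fin (polyDim d q) → ℝ) : Continuous (localBubble q x₀ r a) :=
  ((cutoff d).continuous.comp (by fun_prop : Continuous fun x : E d => r⁻¹ • (x - x₀))).mul
    (continuous_localPoly a)

lemma norm_rescale (hr : 0 < r) (x : E d) : ‖r⁻¹ • (x - x₀)‖ = dist x x₀ / r := by
  rw [norm_smul, norm_inv, Real.norm_of_nonneg hr.le, dist_eq_norm, inv_mul_eq_div]

lemma localBubble_eq_zero (hr : 0 < r) (a : Fin (polyDim d q) → ℝ) {x : E d}
    (hx : r / 2 ≤ dist x x₀) : localBubble q x₀ r a x = 0 := by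
  rw [localBubble_apply, (cutoff d).zero_of_le_dist, zero_mul]
  rw [dist_zero_right, norm_rescale hr, le_div_iff₀ hr]
  change 1 / 2 * r ≤ _
  linarith

lemma abs_localPoly_le {R M : ℝ}
    (hM : ∀ (a : Fin (polyDim d q) → ℝ) (y : E d), ‖y‖ ≤ R → |refPoly q y a| ≤ M * ‖a‖)
    (hr : 0 < r) (a : Fin (polyDim d q) → ℝ) {x : E d} (hx : x ∈ Metric.closedBall x₀ (R * r)) :
    |localPoly q x₀ r a x| ≤ M * ‖a‖ := by
  refine hM a _ ?_
  rw [norm_rescale hr, div_le_iff₀ hr]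
  exact hx

lemma abs_localBubble_le {R M : ℝ} (hR : 1 ≤ R) (hM0 : 0 ≤ M)
    (hM : ∀ (a : Fin (polyDim d q) → ℝ) (y : E d), ‖y‖ ≤ R → |refPoly q y a| ≤ M * ‖a‖)
    (hr : 0 < r) (a : Fin (polyDim d q) → ℝ) (x : E d) :
    |localBubble q x₀ r a x| ≤ M * ‖a‖ := by
  rcases le_or_gt (r / 2) (dist x x₀) with hx | hx
  · rw [localBubble_eq_zero hr a hx, abs_zero]
    positivity
  · rw [localBubble_apply, abs_mul, abs_of_nonneg (cutoff d).nonneg]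
    refine (mul_le_of_le_one_left (abs_nonneg _) (cutoff d).le_one).trans
      (abs_localPoly_le hM hr a ?_)
    rw [Metric.mem_closedBall]
    nlinarith

/-- Rescaling of the coercivity estimate for polynomials on the reference ball. -/
lemma le_integral_ball_localPoly {c : ℝ}
    (hc : ∀ a : Fin (polyDim d q) → ℝ,
      c * ‖a‖ ^ 2 ≤ ∫ y in Metric.ball (0 : E d) (1 / 4), refPoly q y a ^ 2)
    (hr : 0 < r) (a : Fin (polyDim d q) → ℝ) :
    c * r ^ d * ‖a‖ ^ 2 ≤ ∫ x in Metric.ball x₀ (r / 4), localPoly q x₀ r a x ^ 2 := by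
  have hball : ∀ x : E d, x ∈ Metric.ball x₀ (r / 4) ↔
      r⁻¹ • (x - x₀) ∈ Metric.ball (0 : E d) (1 / 4) := fun x => by
    rw [mem_ball_zero_iff, norm_rescale hr, div_lt_iff₀ hr, Metric.mem_ball]
    constructor <;> intro h <;> linarith
  have heq : ∫ x in Metric.ball x₀ (r / 4), localPoly q x₀ r a x ^ 2 =
      r ^ d * ∫ y in Metric.ball (0 : E d) (1 / 4), refPoly q y a ^ 2 := by
    rw [← integral_indicator Metric.isOpen_ball.measurableSet,
      ← integral_indicator Metric.isOpen_ball.measurableSet]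
    set g : E d → ℝ := (Metric.ball (0 : E d) (1 / 4)).indicator fun y => refPoly q y a ^ 2
    have h1 : (Metric.ball x₀ (r / 4)).indicator (fun x => localPoly q x₀ r a x ^ 2) =
        fun x => g (r⁻¹ • (x - x₀)) := by
      ext x
      simp only [g]
      by_cases hx : x ∈ Metric.ball x₀ (r / 4)
      · rw [Set.indicator_of_mem hx, Set.indicator_of_mem ((hball x).1 hx), localPoly_apply]
      · rw [Set.indicator_of_notMem hx, Set.indicator_of_notMem fun h => hx ((hball x).2 h)]
    rw [h1, integral_sub_right_eq_self (fun x => g (r⁻¹ • x)) x₀,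
      Measure.integral_comp_smul volume g r⁻¹]
    simp [abs_of_pos hr]
  rw [heq]
  calc c * r ^ d * ‖a‖ ^ 2 = r ^ d * (c * ‖a‖ ^ 2) := by ring
    _ ≤ _ := mul_le_mul_of_nonneg_left (hc a) (by positivity)

end

section

variable {𝒯 𝒮 : ConformingMesh Ω} {κ η : ℝ} {T : Finset (E d)} {x₀ : E d} {r : ℝ}

/-- A fine element that meets the interior of a coarse one is contained in it. -/
lemma ConformingMesh.Refines.hull_subset (h : 𝒮.Refines 𝒯) (hT : T ∈ 𝒯.elems)
    {U : Finset (E d)} (hU : U ∈ 𝒮.elems) {x : E d} (hxU : x ∈ hull U)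
    (hxT : x ∈ interior (hull T)) : hull U ⊆ hull T := by
  obtain ⟨T', hT', hsub⟩ := h U hU
  rwa [← 𝒯.eq_of_mem_interior hT' hT (hsub hxU) hxT]

lemma IsReferenceBall.closedBall_subset_interior (h : IsReferenceBall 𝒮 κ η T x₀ r) :
    Metric.closedBall x₀ (3 / 4 * r) ⊆ interior (hull T) := by
  refine subset_trans ?_ (interior_mono (Metric.ball_subset_closedBall.trans h.closedBall_subset))
  rw [Metric.isOpen_ball.interior_eq]
  exact Metric.closedBall_subset_ball (by linarith [h.pos])

lemma dist_le_of_mem_hull (h : IsReferenceBall 𝒮 κ η T x₀ r) {U : Finset (E d)}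
    (hU : U ∈ 𝒮.elems) (hUT : hull U ⊆ hull T) {x y : E d} (hx : x ∈ hull U) (hy : y ∈ hull U) :
    dist x y ≤ η * r :=
  (Metric.dist_le_diam_of_mem (isCompact_hull U).isBounded hx hy).trans (h.diam_le U hU hUT)

/-- The interpolated bubble is supported well inside the coarse element. -/
lemma IsReferenceBall.mem_closedBall_of_interp_ne_zero (h : IsReferenceBall 𝒮 κ η T x₀ r)
    (href : 𝒮.Refines 𝒯) (hT : T ∈ 𝒯.elems) (hη : η ≤ 1 / 4) (a : Fin (polyDim d q) → ℝ)
    {x : E d} (hx : 𝒮.interp (localBubble q x₀ r a) x ≠ 0) :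
    x ∈ Metric.closedBall x₀ (3 / 4 * r) := by
  obtain ⟨U, hU, hxU, v, hv, hcv⟩ := 𝒮.exists_vertex_ne_zero_of_interp_ne_zero hx
  have hvx : dist v x₀ < r / 2 := by
    by_contra! h'
    exact hcv (localBubble_eq_zero h.pos a h')
  have hvU : v ∈ hull U := subset_convexHull ℝ _ hv
  have hvT : v ∈ interior (hull T) := h.closedBall_subset_interior (by
    rw [Metric.mem_closedBall]; linarith [h.pos])
  have := dist_le_of_mem_hull h hU (href.hull_subset hT hU hvU hvT) hxU hvU
  rw [Metric.mem_closedBall]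
  have hr := h.pos
  nlinarith [dist_triangle x v x₀]

lemma IsReferenceBall.abs_interp_sub_localBubble_le (h : IsReferenceBall 𝒮 κ η T x₀ r)
    (href : 𝒮.Refines 𝒯) (hT : T ∈ 𝒯.elems) {L : ℝ} (hL0 : 0 ≤ L)
    (hL : ∀ (a : Fin (polyDim d q) → ℝ) (y z : E d),
      |cutoff d y * refPoly q y a - cutoff d z * refPoly q z a| ≤ L * ‖a‖ * ‖y - z‖)
    (a : Fin (polyDim d q) → ℝ) {x : E d} (hx : x ∈ interior (hull T)) :
    |𝒮.interp (localBubble q x₀ r a) x - localBubble q x₀ r a x| ≤ L * ‖a‖ * η := by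
  obtain ⟨U, hU, hxU⟩ := 𝒮.exists_mem_hull (𝒯.hull_subset_closure hT (interior_subset hx))
  have hUT := href.hull_subset hT hU hxU hx
  refine 𝒮.abs_interp_sub_le hU _ hxU fun v hv => ?_
  refine (hL a _ _).trans (mul_le_mul_of_nonneg_left ?_ (by positivity))
  rw [← smul_sub, sub_sub_sub_cancel_right, norm_rescale h.pos, div_le_iff₀ h.pos]
  exact dist_le_of_mem_hull h hU hUT (subset_convexHull ℝ _ hv) hxU

lemma IsReferenceBall.volume_real_interior_le (h : IsReferenceBall 𝒮 κ η T x₀ r) (hκ : 0 ≤ κ) :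
    volume.real (interior (hull T)) ≤ κ ^ d * r ^ d * volume.real (Metric.ball (0 : E d) 1) := by
  calc volume.real (interior (hull T)) ≤ volume.real (Metric.closedBall x₀ (κ * r)) :=
        measureReal_mono (interior_subset.trans h.subset_closedBall)
          measure_closedBall_lt_top.ne
    _ = κ ^ d * r ^ d * volume.real (Metric.ball (0 : E d) 1) := by
        have hr := h.pos
        rw [measureReal_def, Measure.addHaar_closedBall _ _ (by positivity), ENNReal.toReal_mul,
          ENNReal.toReal_ofReal (by positivity), finrank_euclideanSpace_fin, mul_pow,
          measureReal_def]

lemma ConformingMesh.isFiniteMeasure_restrict (𝒯 : ConformingMesh Ω) :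
    IsFiniteMeasure (volume.restrict Ω) := ⟨by simpa using 𝒯.volume_lt_top⟩

lemma restrict_restrict_interior (hT : T ∈ 𝒯.elems) :
    (volume.restrict Ω).restrict (interior (hull T)) = volume.restrict (interior (hull T)) := by
  rw [Measure.restrict_restrict isOpen_interior.measurableSet,
    Set.inter_eq_left.2 (𝒯.interior_subset T hT)]

lemma memLp_truncatedPoly (𝒯 : ConformingMesh Ω) (T : Finset (E d)) (x₀ : E d) (r : ℝ)
    (a : Fin (polyDim d q) → ℝ) :
    MemLp (truncatedPoly q (interior (hull T)) x₀ r a) 2 (volume.restrict Ω) := by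
  have := 𝒯.isFiniteMeasure_restrict
  obtain ⟨C, hC⟩ := (isCompact_hull T).exists_bound_of_continuousOn
    (continuous_localPoly (q := q) (x₀ := x₀) (r := r) a).continuousOn
  rw [truncatedPoly_eq]
  refine MemLp.of_bound ((continuous_localPoly a).measurable.indicator
    isOpen_interior.measurableSet).aestronglyMeasurable |C| (Filter.Eventually.of_forall fun x => ?_)
  by_cases hx : x ∈ interior (hull T)
  · rw [Set.indicator_of_mem hx]
    exact (hC x (interior_subset hx)).trans (le_abs_self _)
  · rw [Set.indicator_of_notMem hx]; simp

/-- The truncated local polynomials as elements of `L_2(Ω)`. -/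
def polyL2 (q : ℕ) (𝒯 : ConformingMesh Ω) (T : Finset (E d)) (x₀ : E d) (r : ℝ) :
    (Fin (polyDim d q) → ℝ) →ₗ[ℝ] L2 Ω :=
  toL2 (truncatedPoly q (interior (hull T)) x₀ r) (memLp_truncatedPoly 𝒯 T x₀ r)

lemma coeFn_polyL2 (a : Fin (polyDim d q) → ℝ) : polyL2 q 𝒯 T x₀ r a =ᵐ[volume.restrict Ω]
    (interior (hull T)).indicator (localPoly q x₀ r a) := by
  have := coeFn_toL2 (truncatedPoly q (interior (hull T)) x₀ r) (memLp_truncatedPoly 𝒯 T x₀ r) a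
  rwa [truncatedPoly_eq] at this

lemma inner_polyL2 (hT : T ∈ 𝒯.elems) (a : Fin (polyDim d q) → ℝ) (w : L2 Ω) :
    inner ℝ (polyL2 q 𝒯 T x₀ r a) w = ∫ x in interior (hull T), localPoly q x₀ r a x * w x := by
  rw [L2.inner_def, ← restrict_restrict_interior hT,
    ← integral_indicator isOpen_interior.measurableSet]
  refine integral_congr_ae ?_
  filter_upwards [coeFn_polyL2 (𝒯 := 𝒯) (T := T) (x₀ := x₀) (r := r) a] with x hx
  rw [hx]
  by_cases hxT : x ∈ interior (hull T) <;> simp [hxT, mul_comm]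

lemma ConformingMesh.continuousOn_interp (𝒮 : ConformingMesh Ω) (c : E d → ℝ) :
    ContinuousOn (𝒮.interp c) (closure Ω) := by
  have hlf : LocallyFinite fun T : 𝒮.elems => hull (T : Finset (E d)) := locallyFinite_of_finite _
  have := hlf.continuousOn_iUnion (g := 𝒮.interp c) (fun T => (isCompact_hull _).isClosed)
    fun T => (vertexInterp (T : Finset (E d)) c).continuous.continuousOn.congr
      fun x hx => 𝒮.interp_eq T.2 c hx
  rwa [Set.iUnion_subtype, 𝒮.cover] at this

lemma memLp_interp (𝒮 : ConformingMesh Ω) (hΩ : IsOpen Ω) (c : E d → ℝ) :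
    MemLp (𝒮.interp c) 2 (volume.restrict Ω) := by
  have := 𝒮.isFiniteMeasure_restrict
  have hc := 𝒮.continuousOn_interp c
  obtain ⟨C, hC⟩ := 𝒮.isCompact_closure.exists_bound_of_continuousOn hc
  exact MemLp.of_bound ((hc.mono subset_closure).aestronglyMeasurable hΩ.measurableSet) C
    ((ae_restrict_mem hΩ.measurableSet).mono fun x hx => hC x (subset_closure hx))

/-- The interpolated bubbles as elements of `L_2(Ω)`. -/
def bubbleL2 (q : ℕ) (𝒮 : ConformingMesh Ω) (hΩ : IsOpen Ω) (x₀ : E d) (r : ℝ) :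
    (Fin (polyDim d q) → ℝ) →ₗ[ℝ] L2 Ω :=
  toL2 (𝒮.interpₗ ∘ₗ localBubble q x₀ r) fun _ => memLp_interp 𝒮 hΩ _

lemma coeFn_bubbleL2 (hΩ : IsOpen Ω) (a : Fin (polyDim d q) → ℝ) :
    bubbleL2 q 𝒮 hΩ x₀ r a =ᵐ[volume.restrict Ω] 𝒮.interp (localBubble q x₀ r a) :=
  coeFn_toL2 (𝒮.interpₗ ∘ₗ localBubble q x₀ r) (fun _ => memLp_interp 𝒮 hΩ _) a

lemma inner_polyL2_bubbleL2 (hΩ : IsOpen Ω) (hT : T ∈ 𝒯.elems) {x₁ : E d} {r₁ : ℝ}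
    (a b : Fin (polyDim d q) → ℝ) :
    inner ℝ (polyL2 q 𝒯 T x₀ r a) (bubbleL2 q 𝒮 hΩ x₁ r₁ b) =
      ∫ x in interior (hull T), localPoly q x₀ r a x * 𝒮.interp (localBubble q x₁ r₁ b) x := by
  rw [inner_polyL2 hT]
  refine integral_congr_ae ?_
  have := ae_restrict_of_ae (s := interior (hull T))
    (coeFn_bubbleL2 (𝒮 := 𝒮) (x₀ := x₁) (r := r₁) hΩ b)
  rw [restrict_restrict_interior hT] at this
  filter_upwards [this] with x hx
  rw [hx]

/-- Polynomials and interpolated bubbles that belong to different coarse elements are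
orthogonal. -/
lemma inner_polyL2_bubbleL2_eq_zero (hΩ : IsOpen Ω) (href : 𝒮.Refines 𝒯) (hη : η ≤ 1 / 4)
    (hT : T ∈ 𝒯.elems) {U : Finset (E d)} (hU : U ∈ 𝒯.elems) (hne : T ≠ U) {x₁ : E d} {r₁ : ℝ}
    (h : IsReferenceBall 𝒮 κ η U x₁ r₁) (a b : Fin (polyDim d q) → ℝ) :
    inner ℝ (polyL2 q 𝒯 T x₀ r a) (bubbleL2 q 𝒮 hΩ x₁ r₁ b) = 0 := by
  rw [inner_polyL2_bubbleL2 hΩ hT]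
  refine setIntegral_eq_zero_of_forall_eq_zero fun x hx => ?_
  have : 𝒮.interp (localBubble q x₁ r₁ b) x = 0 := by
    by_contra h0
    exact 𝒯.disjoint_interior hT hU hne (interior_subset hx)
      (h.closedBall_subset_interior (h.mem_closedBall_of_interp_ne_zero href hU hη b h0))
  rw [this, mul_zero]

/-- Coercivity of the pairing of polynomials with interpolated bubbles: without interpolation the
pairing is bounded from below by the squared norm on the ball where the cutoff function is `1`, and
the interpolation error is small. -/
lemma le_inner_polyL2_bubbleL2 (hΩ : IsOpen Ω) (href : 𝒮.Refines 𝒯) (hT : T ∈ 𝒯.elems)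
    (h : IsReferenceBall 𝒮 κ η T x₀ r) (hκ : 0 ≤ κ) (hη0 : 0 ≤ η) {c M L : ℝ}
    (hM0 : 0 ≤ M) (hL0 : 0 ≤ L)
    (hc : ∀ a : Fin (polyDim d q) → ℝ,
      c * ‖a‖ ^ 2 ≤ ∫ y in Metric.ball (0 : E d) (1 / 4), refPoly q y a ^ 2)
    (hM : ∀ (a : Fin (polyDim d q) → ℝ) (y : E d), ‖y‖ ≤ κ → |refPoly q y a| ≤ M * ‖a‖)
    (hL : ∀ (a : Fin (polyDim d q) → ℝ) (y z : E d),
      |cutoff d y * refPoly q y a - cutoff d z * refPoly q z a| ≤ L * ‖a‖ * ‖y - z‖)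
    (hsmall : M * L * η * (κ ^ d * volume.real (Metric.ball (0 : E d) 1)) ≤ c / 2)
    (a : Fin (polyDim d q) → ℝ) :
    c / 2 * r ^ d * ‖a‖ ^ 2 ≤
      inner ℝ (polyL2 q 𝒯 T x₀ r a) (bubbleL2 q 𝒮 hΩ x₀ r a) := by
  have hr := h.pos
  rw [inner_polyL2_bubbleL2 hΩ hT]
  set S := interior (hull T)
  have hS : MeasurableSet S := isOpen_interior.measurableSet
  set p := localPoly q x₀ r a
  set b := localBubble q x₀ r a
  set k : ℝ := M * ‖a‖ * (L * ‖a‖ * η)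
  have hcomp : ∀ {g : E d → ℝ}, ContinuousOn g (hull T) → IntegrableOn g S := fun hg =>
    (hg.integrableOn_compact (isCompact_hull T)).mono_set interior_subset
  have hp : Continuous p := continuous_localPoly a
  have hb : Continuous b := continuous_localBubble a
  have hI : ContinuousOn (𝒮.interp b) (hull T) :=
    (𝒮.continuousOn_interp b).mono (𝒯.hull_subset_closure hT)
  have hk : IntegrableOn (fun _ => k) S := hcomp continuousOn_const
  have hpoint : ∀ x ∈ S, p x * b x - k ≤ p x * 𝒮.interp b x := fun x hx => by
    have h1 : |p x| ≤ M * ‖a‖ :=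
      abs_localPoly_le hM hr a (h.subset_closedBall (interior_subset hx))
    have h2 := h.abs_interp_sub_localBubble_le href hT hL0 hL a hx
    have h3 : |p x * (𝒮.interp b x - b x)| ≤ k := by
      rw [abs_mul]
      exact mul_le_mul h1 h2 (abs_nonneg _) (by positivity)
    linarith [(abs_le.1 h3).1]
  have hball : Metric.ball x₀ (r / 4) ⊆ S :=
    (Metric.ball_subset_closedBall.trans (Metric.closedBall_subset_closedBall (by linarith))).trans
      h.closedBall_subset_interior
  have hlow : c * r ^ d * ‖a‖ ^ 2 ≤ ∫ x in S, p x * b x := by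
    refine (le_integral_ball_localPoly (x₀ := x₀) hc hr a).trans ?_
    have h1 : ∀ x, p x * b x = cutoff d (r⁻¹ • (x - x₀)) * p x ^ 2 := fun x => by
      simp only [p, b, localBubble_apply]; ring
    have h2 : ∫ x in Metric.ball x₀ (r / 4), p x ^ 2 =
        ∫ x in Metric.ball x₀ (r / 4), p x * b x := by
      refine setIntegral_congr_fun Metric.isOpen_ball.measurableSet fun x hx => ?_
      have : cutoff d (r⁻¹ • (x - x₀)) = 1 := by
        refine (cutoff d).one_of_mem_closedBall ?_
        rw [mem_closedBall_zero_iff, norm_rescale hr, div_le_iff₀ hr]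
        change _ ≤ 1 / 4 * r
        rw [Metric.mem_ball] at hx
        linarith
      simp only [h1, this, one_mul]
    rw [h2]
    refine setIntegral_mono_set (hcomp (hp.mul hb).continuousOn)
      (Filter.Eventually.of_forall fun x => ?_) hball.eventuallyLE
    change 0 ≤ p x * b x
    rw [h1]
    exact mul_nonneg (cutoff d).nonneg (sq_nonneg _)
  have hkS : volume.real S * k ≤ c / 2 * r ^ d * ‖a‖ ^ 2 := by
    calc volume.real S * k
        ≤ (κ ^ d * r ^ d * volume.real (Metric.ball (0 : E d) 1)) * k :=
          mul_le_mul_of_nonneg_right (h.volume_real_interior_le hκ) (by positivity)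
      _ = M * L * η * (κ ^ d * volume.real (Metric.ball (0 : E d) 1)) * (r ^ d * ‖a‖ ^ 2) := by
          simp only [k]; ring
      _ ≤ c / 2 * (r ^ d * ‖a‖ ^ 2) := mul_le_mul_of_nonneg_right hsmall (by positivity)
      _ = _ := by ring
  calc c / 2 * r ^ d * ‖a‖ ^ 2 ≤ (∫ x in S, p x * b x) - ∫ x in S, k := by
        rw [setIntegral_const, smul_eq_mul]
        linarith
    _ = ∫ x in S, (p x * b x - k) :=
        (integral_sub (hcomp (hp.mul hb).continuousOn) hk).symm
    _ ≤ ∫ x in S, p x * 𝒮.interp b x :=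
        setIntegral_mono_on ((hcomp (hp.mul hb).continuousOn).sub hk)
          (hcomp (hp.continuousOn.mul hI)) hS hpoint

end

end

section

variable {d q : ℕ} {Ω : Set (E d)} {𝒯 𝒮 : ConformingMesh Ω} {κ η : ℝ}

/-! ### Properties of the range and of the adjoint -/

lemma mem_brokenPoly_of_ae_eq_interp (hq : 1 ≤ q) {w : L2 Ω} {c : E d → ℝ}
    (hw : w =ᵐ[volume.restrict Ω] 𝒮.interp c) : w ∈ 𝒮.brokenPoly q := fun T hT => by
  obtain ⟨p, hp, hpe⟩ := exists_polynomial_eq_affine (vertexInterp T c)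
  refine ⟨p, hp.trans hq, ?_⟩
  filter_upwards [hw] with x hx hxT
  rw [hx, 𝒮.interp_eq hT c hxT, hpe]

/-- An interpolant supported in a compact subset of `Ω` belongs to `H^1_0(Ω)`. -/
lemma mem_H10_of_ae_eq_interp (hΩ : IsOpen Ω) {w : L2 Ω} {c : E d → ℝ}
    (hw : w =ᵐ[volume.restrict Ω] 𝒮.interp c) {Z : Set (E d)} (hZ : IsCompact Z) (hZΩ : Z ⊆ Ω)
    (hc : ∀ x, 𝒮.interp c x ≠ 0 → x ∈ Z) : w ∈ H10 Ω := by
  obtain ⟨L, hL⟩ := 𝒮.exists_lipschitzWith_interp hΩ (c := c) fun x hx => by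
    by_contra h
    exact hx (hZΩ (hc x h))
  have hts : tsupport (𝒮.interp c) ⊆ Z := closure_minimal hc hZ.isClosed
  refine mem_H10_of_lipschitz_of_locally_affine hΩ 𝒮.volume_lt_top hL
    (hZ.of_isClosed_subset (isClosed_tsupport _) hts) (hts.trans hZΩ) ?_ hw
  filter_upwards [𝒮.ae_mem_interior] with x ⟨T, hT, hx⟩
  exact ⟨vertexInterp T c, Filter.eventually_of_mem (mem_interior_iff_mem_nhds.1 hx)
    fun y hy => 𝒮.interp_eq hT c hy⟩

section

variable {x₀ : 𝒯.elems → E d} {r : 𝒯.elems → ℝ}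

lemma coeFn_sum_bubbleL2 (hΩ : IsOpen Ω) (a : 𝒯.elems → Fin (polyDim d q) → ℝ) :
    (∑ k, bubbleL2 q 𝒮 hΩ (x₀ k) (r k) (a k) : L2 Ω) =ᵐ[volume.restrict Ω]
      𝒮.interp (∑ k, localBubble q (x₀ k) (r k) (a k)) := by
  have h : ∀ k, bubbleL2 q 𝒮 hΩ (x₀ k) (r k) (a k) =ᵐ[volume.restrict Ω]
      𝒮.interp (localBubble q (x₀ k) (r k) (a k)) := fun k => coeFn_bubbleL2 hΩ (a k)
  filter_upwards [Lp.coeFn_finsetSum Finset.univ fun k => bubbleL2 q 𝒮 hΩ (x₀ k) (r k) (a k),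
    Filter.eventually_all.2 h] with x hx hx'
  rw [hx, Finset.sum_apply]
  simp only [hx']
  have := congrFun (map_sum 𝒮.interpₗ (fun k => localBubble q (x₀ k) (r k) (a k)) Finset.univ) x
  rw [Finset.sum_apply] at this
  exact this.symm

lemma exists_mem_closedBall_of_interp_sum_ne_zero (href : 𝒮.Refines 𝒯) (hη : η ≤ 1 / 4)
    (h : ∀ k : 𝒯.elems, IsReferenceBall 𝒮 κ η k (x₀ k) (r k))
    (a : 𝒯.elems → Fin (polyDim d q) → ℝ) {x : E d}
    (hx : 𝒮.interp (∑ k, localBubble q (x₀ k) (r k) (a k)) x ≠ 0) :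
    ∃ k, x ∈ Metric.closedBall (x₀ k) (3 / 4 * r k) := by
  have h1 := congrFun (map_sum 𝒮.interpₗ (fun k => localBubble q (x₀ k) (r k) (a k)) Finset.univ) x
  rw [Finset.sum_apply] at h1
  change 𝒮.interp _ x = ∑ k, 𝒮.interp (localBubble q (x₀ k) (r k) (a k)) x at h1
  rw [h1] at hx
  obtain ⟨k, -, hk⟩ := Finset.exists_ne_zero_of_sum_ne_zero hx
  exact ⟨k, (h k).mem_closedBall_of_interp_ne_zero href k.2 hη (a k) hk⟩

lemma sum_bubbleL2_mem (hq : 1 ≤ q) (hΩ : IsOpen Ω) (href : 𝒮.Refines 𝒯) (hη : η ≤ 1 / 4)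
    (h : ∀ k : 𝒯.elems, IsReferenceBall 𝒮 κ η k (x₀ k) (r k))
    (a : 𝒯.elems → Fin (polyDim d q) → ℝ) :
    ∑ k, bubbleL2 q 𝒮 hΩ (x₀ k) (r k) (a k) ∈ 𝒮.conformingPoly q ∧
      𝒯.VanishesOnSkeleton (∑ k, bubbleL2 q 𝒮 hΩ (x₀ k) (r k) (a k)) := by
  have hae := coeFn_sum_bubbleL2 (𝒮 := 𝒮) (x₀ := x₀) (r := r) hΩ a
  have hsupp := fun x => exists_mem_closedBall_of_interp_sum_ne_zero (x := x) href hη h a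
  refine ⟨⟨mem_brokenPoly_of_ae_eq_interp hq hae, mem_H10_of_ae_eq_interp hΩ hae
    (isCompact_iUnion fun k => isCompact_closedBall (x₀ k) (3 / 4 * r k)) ?_ fun x hx => ?_⟩,
    _, 𝒮.continuousOn_interp _, hae, fun x hx => ?_⟩
  · exact Set.iUnion_subset fun k =>
      (h k).closedBall_subset_interior.trans (𝒯.interior_subset k k.2)
  · exact Set.mem_iUnion.2 (hsupp x hx)
  · by_contra h0
    obtain ⟨k, hk⟩ := hsupp x h0
    have hk' := (h k).closedBall_subset_interior hk
    simp only [ConformingMesh.skeleton, Set.mem_iUnion] at hx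
    obtain ⟨T, hT, hxT⟩ := hx
    have hTk := 𝒯.eq_of_mem_interior hT k.2 ((isCompact_hull T).isClosed.frontier_subset hxT) hk'
    rw [← hTk] at hk'
    exact hxT.2 hk'

/-- Every broken polynomial is a sum of truncated local polynomials. -/
lemma exists_eq_sum_polyL2 (hr : ∀ k, r k ≠ 0) {f : L2 Ω} (hf : f ∈ 𝒯.brokenPoly q) :
    ∃ a : 𝒯.elems → Fin (polyDim d q) → ℝ, 
      f = ∑ k : 𝒯.elems, polyL2 q 𝒯 k (x₀ k) (r k) (a k) := by
  choose p hp hpf using fun k : 𝒯.elems => hf k k.2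
  choose a ha using fun k => exists_refPoly_rescale (p k) (hp k) (x₀ k) (hr k)
  refine ⟨a, Lp.ext ?_⟩
  have h : ∀ k : 𝒯.elems, polyL2 q 𝒯 k (x₀ k) (r k) (a k) =ᵐ[volume.restrict Ω]
      (interior (hull (k : Finset (E d)))).indicator (localPoly q (x₀ k) (r k) (a k)) :=
    fun k => coeFn_polyL2 (a k)
  filter_upwards [Lp.coeFn_finsetSum Finset.univ fun k : 𝒯.elems => polyL2 q 𝒯 k (x₀ k) (r k) (a k),
    Filter.eventually_all.2 h, Filter.eventually_all.2 hpf, 𝒯.ae_mem_interior]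
    with x hx hx' hxp ⟨T, hT, hxT⟩
  rw [hx, Finset.sum_apply]
  simp only [hx']
  rw [Finset.sum_eq_single ⟨T, hT⟩ (fun k _ hk => ?_) (by simp), Set.indicator_of_mem hxT,
    hxp ⟨T, hT⟩ (interior_subset hxT), ha]
  · rfl
  · refine Set.indicator_of_notMem (fun hxk => hk ?_) _
    exact Subtype.ext (𝒯.eq_of_mem_interior k.2 hT (interior_subset hxk) hxT)

end

/-! ### The local stability bound -/

lemma eLpNorm_le_of_abs_le {S : Set (E d)} (hS : volume S ≠ ⊤) {μ : Measure (E d)}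
    (hμ : μ = volume.restrict S) {g : E d → ℝ} {K : ℝ}
    (hg : ∀ᵐ x ∂μ, |g x| ≤ K) :
    eLpNorm g 2 μ ≤ ENNReal.ofReal (√(volume.real S) * K) := by
  refine (eLpNorm_le_of_ae_bound hg).trans (le_of_eq ?_)
  subst hμ
  rw [Measure.restrict_apply_univ, ENNReal.ofReal_mul (Real.sqrt_nonneg _), Real.sqrt_eq_rpow,
    ← ENNReal.ofReal_rpow_of_nonneg measureReal_nonneg (by norm_num), measureReal_def,
    ENNReal.ofReal_toReal hS]
  norm_num

/-- The local stability estimate for a combination `a` of bubbles that is controlled by `w`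
through the coercivity estimate. -/
lemma eLpNorm_bubble_le {T : Finset (E d)} {x₀ : E d} {r : ℝ}
    (hT : T ∈ 𝒯.elems) (h : IsReferenceBall 𝒮 κ η T x₀ r) (hκ : 1 ≤ κ) {c M : ℝ}
    (hc : 0 < c) (hM0 : 0 ≤ M)
    (hM : ∀ (a : Fin (polyDim d q) → ℝ) (y : E d), ‖y‖ ≤ κ → |refPoly q y a| ≤ M * ‖a‖)
    {a : Fin (polyDim d q) → ℝ} {w : L2 Ω}
    (hw : c / 2 * r ^ d * ‖a‖ ^ 2 ≤ inner ℝ (polyL2 q 𝒯 T x₀ r a) w) {g : E d → ℝ}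
    (hg : ∀ᵐ x ∂(volume.restrict Ω).restrict (hull T),
      g x = 𝒮.interp (localBubble q x₀ r a) x) :
    eLpNorm g 2 ((volume.restrict Ω).restrict (hull T)) ≤
      ENNReal.ofReal (M ^ 2 * (κ ^ d * volume.real (Metric.ball (0 : E d) 1)) / (c / 2)) *
        eLpNorm w 2 ((volume.restrict Ω).restrict (hull T)) := by
  have hr := h.pos
  rw [𝒯.restrict_hull hT] at hg ⊢
  set S := interior (hull T)
  set B := volume.real (Metric.ball (0 : E d) 1)
  have hB : 0 ≤ B := measureReal_nonneg
  have hS : MeasurableSet S := isOpen_interior.measurableSet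
  have hSfin : volume S ≠ ⊤ :=
    ((measure_mono interior_subset).trans_lt (isCompact_hull T).measure_lt_top).ne
  have hSr : (volume.restrict Ω).restrict S = volume.restrict S := restrict_restrict_interior hT
  have hwfin : eLpNorm w 2 (volume.restrict S) ≠ ⊤ := by
    rw [← hSr]
    exact ((Lp.memLp w).restrict S).eLpNorm_ne_top
  set N := (eLpNorm w 2 (volume.restrict S)).toReal
  set s := √(volume.real S)
  have hs2 : s ^ 2 ≤ κ ^ d * B * r ^ d := by
    rw [Real.sq_sqrt measureReal_nonneg]
    exact (h.volume_real_interior_le (by linarith)).trans (le_of_eq (by ring))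
  have hinner : inner ℝ (polyL2 q 𝒯 T x₀ r a) w ≤ s * (M * ‖a‖) * N := by
    have hwS : MemLp (S.indicator w) 2 (volume.restrict Ω) := (Lp.memLp w).indicator hS
    -- Only the restriction of `w` to `T` contributes to the inner product.
    have h1 : inner ℝ (polyL2 q 𝒯 T x₀ r a) w =
        inner ℝ (polyL2 q 𝒯 T x₀ r a) (hwS.toLp _) := by
      rw [inner_polyL2 hT, inner_polyL2 hT]
      refine integral_congr_ae ?_
      have h2 := ae_restrict_of_ae (s := S) hwS.coeFn_toLp
      rw [hSr] at h2
      filter_upwards [h2, ae_restrict_mem hS] with x hx hxS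
      rw [hx, Set.indicator_of_mem hxS]
    rw [h1]
    refine (real_inner_le_norm _ _).trans (mul_le_mul ?_ (le_of_eq ?_) (norm_nonneg _)
      (by positivity))
    · rw [Lp.norm_def, eLpNorm_congr_ae (coeFn_polyL2 a),
        eLpNorm_indicator_eq_eLpNorm_restrict hS, hSr]
      refine ENNReal.toReal_le_of_le_ofReal (by positivity)
        (eLpNorm_le_of_abs_le hSfin rfl ?_)
      filter_upwards [ae_restrict_mem hS] with x hx
      exact abs_localPoly_le hM hr a (h.subset_closedBall (interior_subset hx))
    · rw [Lp.norm_toLp, eLpNorm_indicator_eq_eLpNorm_restrict hS, hSr]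
  have hfinal : s * (M * ‖a‖) ≤ M ^ 2 * (κ ^ d * B) / (c / 2) * N := by
    have hN : 0 ≤ N := ENNReal.toReal_nonneg
    have hs : 0 ≤ s := Real.sqrt_nonneg _
    have ha : c / 2 * r ^ d * ‖a‖ ≤ s * M * N := by
      rcases (norm_nonneg a).eq_or_lt with h0 | h0
      · rw [← h0, mul_zero]; positivity
      · refine le_of_mul_le_mul_right ?_ h0
        calc c / 2 * r ^ d * ‖a‖ * ‖a‖ = c / 2 * r ^ d * ‖a‖ ^ 2 := by ring
          _ ≤ s * (M * ‖a‖) * N := hw.trans hinner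
          _ = s * M * N * ‖a‖ := by ring
    rw [div_mul_eq_mul_div, le_div_iff₀ (by positivity)]
    refine le_of_mul_le_mul_right ?_ (by positivity : 0 < r ^ d)
    calc s * (M * ‖a‖) * (c / 2) * r ^ d = s * M * (c / 2 * r ^ d * ‖a‖) := by ring
      _ ≤ s * M * (s * M * N) := by gcongr
      _ = M ^ 2 * N * s ^ 2 := by ring
      _ ≤ M ^ 2 * N * (κ ^ d * B * r ^ d) := by gcongr
      _ = M ^ 2 * (κ ^ d * B) * N * r ^ d := by ring
  calc eLpNorm g 2 (volume.restrict S) ≤ ENNReal.ofReal (s * (M * ‖a‖)) :=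
        eLpNorm_le_of_abs_le hSfin rfl (hg.mono fun x hx => by
          rw [hx]
          exact 𝒮.abs_interp_le _ (abs_localBubble_le hκ hM0 hM hr a) x)
    _ ≤ ENNReal.ofReal (M ^ 2 * (κ ^ d * B) / (c / 2) * N) := ENNReal.ofReal_le_ofReal hfinal
    _ = _ := by
        rw [ENNReal.ofReal_mul (by positivity), ENNReal.ofReal_toReal hwfin]

lemma sum_bubbleL2_ae_eq_of_mem {x₀ : 𝒯.elems → E d} {r : 𝒯.elems → ℝ} (hΩ : IsOpen Ω)
    (href : 𝒮.Refines 𝒯) (hη : η ≤ 1 / 4)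
    (h : ∀ k : 𝒯.elems, IsReferenceBall 𝒮 κ η k (x₀ k) (r k))
    (a : 𝒯.elems → Fin (polyDim d q) → ℝ) (k : 𝒯.elems) :
    ∀ᵐ x ∂(volume.restrict Ω).restrict (hull (k : Finset (E d))),
      (∑ l, bubbleL2 q 𝒮 hΩ (x₀ l) (r l) (a l) : L2 Ω) x =
        𝒮.interp (localBubble q (x₀ k) (r k) (a k)) x := by
  filter_upwards [ae_restrict_of_ae (coeFn_sum_bubbleL2 (𝒮 := 𝒮) (x₀ := x₀) (r := r) hΩ a),
    ae_restrict_mem (isCompact_hull (k : Finset (E d))).isClosed.measurableSet] with x hx hxk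
  have h1 := congrFun (map_sum 𝒮.interpₗ (fun k => localBubble q (x₀ k) (r k) (a k)) Finset.univ) x
  rw [Finset.sum_apply] at h1
  rw [hx]
  refine h1.trans (Finset.sum_eq_single k (fun l _ hl => ?_) (by simp))
  by_contra h0
  have h2 := (h l).closedBall_subset_interior
    ((h l).mem_closedBall_of_interp_ne_zero href l.2 hη (a l) h0)
  exact hl (Subtype.ext (𝒯.eq_of_mem_interior k.2 l.2 hxk h2)).symm

/-! ### Mesh size from volume ratios -/

/-- Under shape regularity, a small volume ratio makes the fine elements small in diameter: if `U`
contains a ball of radius `r₁`, comparing volumes of balls gives `r₁ ≤ η / κ ^ 2 * (κ * r)`, and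
`U` has diameter at most `κ * r₁`. -/
lemma exists_isReferenceBall (hκ : 1 ≤ κ) (hη : 0 < η) (h𝒯 : 𝒯.ShapeRegular κ)
    (h𝒮 : 𝒮.ShapeRegular κ) {T : Finset (E d)} (hT : T ∈ 𝒯.elems)
    (hσ : ∀ U ∈ 𝒮.elems, hull U ⊆ hull T →
      volume (hull U) / volume (hull T) ≤ ENNReal.ofReal ((η / κ ^ 2) ^ d)) (hd : 1 ≤ d) :
    ∃ x₀ r, IsReferenceBall 𝒮 κ η T x₀ r := by
  obtain ⟨x₀, r, hr, hball, hdiam⟩ := h𝒯 T hT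
  have hsub : hull T ⊆ Metric.closedBall x₀ (κ * r) := fun y hy =>
    (Metric.dist_le_diam_of_mem (isCompact_hull T).isBounded hy
      (hball (Metric.mem_closedBall_self hr.le))).trans hdiam
  refine ⟨x₀, r, hr, hball, hsub, fun U hU hUT => ?_⟩
  obtain ⟨x₁, r₁, hr₁, hball₁, hdiam₁⟩ := h𝒮 U hU
  have hpos : volume (hull T) ≠ 0 :=
    ((Metric.measure_closedBall_pos volume x₀ hr).trans_le (measure_mono hball)).ne'
  have hfin : volume (hull T) ≠ ⊤ := (isCompact_hull T).measure_lt_top.ne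
  have h1 := hσ U hU hUT
  rw [ENNReal.div_le_iff hpos hfin] at h1
  have hv : volume (Metric.ball (0 : E d) 1) ≠ 0 := (Metric.measure_ball_pos _ _ one_pos).ne'
  have h2 : ENNReal.ofReal (r₁ ^ d) * volume (Metric.ball (0 : E d) 1) ≤
      ENNReal.ofReal ((η / κ ^ 2) ^ d * (κ * r) ^ d) * volume (Metric.ball (0 : E d) 1) := by
    have h3 := (measure_mono hball₁).trans (h1.trans (mul_le_mul_right (measure_mono hsub) _))
    rw [Measure.addHaar_closedBall _ _ hr₁.le, Measure.addHaar_closedBall _ _ (by positivity),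
      finrank_euclideanSpace_fin, ← mul_assoc, ← ENNReal.ofReal_mul (by positivity)] at h3
    exact h3
  rw [ENNReal.mul_le_mul_iff_left hv measure_ball_lt_top.ne,
    ENNReal.ofReal_le_ofReal_iff (by positivity), ← mul_pow,
    pow_le_pow_iff_left₀ hr₁.le (by positivity) (by omega)] at h2
  calc Metric.diam (hull U) ≤ κ * r₁ := hdiam₁
    _ ≤ κ * (η / κ ^ 2 * (κ * r)) := by gcongr
    _ = η * r := by field_simp

lemma ConformingMesh.ShapeRegular.mono {κ' : ℝ} (h : 𝒯.ShapeRegular κ) (hκ : κ ≤ κ') :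
    𝒯.ShapeRegular κ' := fun T hT => by
  obtain ⟨x, r, hr, hb, hdiam⟩ := h T hT
  exact ⟨x, r, hr, hb, hdiam.trans (by gcongr)⟩

/-! ### The projectors -/

/-- The properties required of the projector for a single pair of meshes. -/
structure IsLocalProjector (𝒯 𝒮 : ConformingMesh Ω) (q : ℕ) (C : ℝ≥0∞) (P : L2 Ω →L[ℝ] L2 Ω) :
    Prop where
  idem : IsIdempotentElem P
  brokenPoly_subset : 𝒯.brokenPoly q ⊆ Set.range (ContinuousLinearMap.adjoint P)
  range_subset : Set.range P ⊆ {w | w ∈ 𝒮.conformingPoly q ∧ 𝒯.VanishesOnSkeleton w}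
  eLpNorm_le : ∀ T' ∈ 𝒯.elems, ∀ w : L2 Ω,
    eLpNorm (P w) 2 ((volume.restrict Ω).restrict (hull T')) ≤
      C * eLpNorm w 2 ((volume.restrict Ω).restrict (hull T'))

/-- The projector for a single pair of meshes, with a stability constant in terms of the constants
of the reference estimates. -/
lemma exists_local_projector (hd : 1 ≤ d) (hq : 1 ≤ q) (hΩ : IsOpen Ω) (href : 𝒮.Refines 𝒯)
    (h𝒯 : 𝒯.ShapeRegular κ) (h𝒮 : 𝒮.ShapeRegular κ) (hκ : 1 ≤ κ) (hη0 : 0 < η) (hη : η ≤ 1 / 4)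
    {c M L : ℝ} (hc0 : 0 < c) (hM0 : 0 ≤ M) (hL0 : 0 ≤ L)
    (hc : ∀ a : Fin (polyDim d q) → ℝ,
      c * ‖a‖ ^ 2 ≤ ∫ y in Metric.ball (0 : E d) (1 / 4), refPoly q y a ^ 2)
    (hM : ∀ (a : Fin (polyDim d q) → ℝ) (y : E d), ‖y‖ ≤ κ → |refPoly q y a| ≤ M * ‖a‖)
    (hL : ∀ (a : Fin (polyDim d q) → ℝ) (y z : E d),
      |cutoff d y * refPoly q y a - cutoff d z * refPoly q z a| ≤ L * ‖a‖ * ‖y - z‖)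
    (hsmall : M * L * η * (κ ^ d * volume.real (Metric.ball (0 : E d) 1)) ≤ c / 2)
    (hσ : ∀ T ∈ 𝒯.elems, ∀ U ∈ 𝒮.elems, hull U ⊆ hull T →
      volume (hull U) / volume (hull T) ≤ ENNReal.ofReal ((η / κ ^ 2) ^ d)) :
    ∃ P : L2 Ω →L[ℝ] L2 Ω, IsLocalProjector 𝒯 𝒮 q
      (ENNReal.ofReal (M ^ 2 * (κ ^ d * volume.real (Metric.ball (0 : E d) 1)) / (c / 2))) P := by
  have hball : ∀ k : 𝒯.elems, ∃ x₀ r, IsReferenceBall 𝒮 κ η k x₀ r := fun k =>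
    exists_isReferenceBall hκ hη0 h𝒯 h𝒮 k.2 (hσ k k.2) hd
  choose x₀ r h using hball
  obtain ⟨α, P, hP, hidem, hadj, hα⟩ := exists_biorthogonal_projector
    (fun k : 𝒯.elems => polyL2 q 𝒯 k (x₀ k) (r k)) (fun k : 𝒯.elems => bubbleL2 q 𝒮 hΩ (x₀ k) (r k))
    (c := fun k => c / 2 * r k ^ d) (fun k => by have := (h k).pos; positivity)
    (fun k a => le_inner_polyL2_bubbleL2 hΩ href k.2 (h k) (by linarith) hη0.le hM0
      hL0 hc hM hL hsmall a)
    (fun k l hkl a b => inner_polyL2_bubbleL2_eq_zero hΩ href hη k.2 l.2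
      (fun h' => hkl (Subtype.ext h')) (h l) a b)
  refine ⟨P, hidem, fun f hf => ?_, ?_, fun T hT w => ?_⟩
  · obtain ⟨a, rfl⟩ := exists_eq_sum_polyL2 (x₀ := x₀) (fun k => (h k).pos.ne') hf
    exact hadj a
  · rintro _ ⟨w, rfl⟩
    rw [hP]
    exact sum_bubbleL2_mem hq hΩ href hη h _
  · refine eLpNorm_bubble_le hT (h ⟨T, hT⟩) hκ hc0 hM0 hM (hα ⟨T, hT⟩ w) ?_
    rw [hP]
    exact sum_bubbleL2_ae_eq_of_mem hΩ href hη h (fun k => α k w) ⟨T, hT⟩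

/-- The constants of the reference estimates, and hence the required refinement depth and the
stability constant, depend only on `d`, `q` and `κ`. -/
lemma exists_uniform_projector (hd : 1 ≤ d) (hq : 1 ≤ q) (κ : ℝ) :
    ∃ σ₀ : ℝ≥0, 0 < σ₀ ∧ ∃ C : ℝ≥0, ∀ {Ω : Set (E d)} (𝒯 𝒮 : ConformingMesh Ω), IsOpen Ω →
      𝒯.ShapeRegular κ → 𝒮.ShapeRegular κ → 𝒮.Refines 𝒯 →
      (∀ T ∈ 𝒯.elems, ∀ U ∈ 𝒮.elems, hull U ⊆ hull T →
        volume (hull U) / volume (hull T) ≤ σ₀) →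
      ∃ P : L2 Ω →L[ℝ] L2 Ω, IsLocalProjector 𝒯 𝒮 q C P := by
  -- Enlarging the shape regularity constant, it may be assumed to be at least `1`.
  obtain ⟨κ₁, hκκ₁, hκ₁⟩ : ∃ κ₁, κ ≤ κ₁ ∧ 1 ≤ κ₁ := ⟨_, le_max_left κ 1, le_max_right κ 1⟩
  obtain ⟨c, hc0, hc⟩ := exists_coercive_refPoly d q
  obtain ⟨M, hM0, hM⟩ := exists_refPoly_le d q κ₁
  obtain ⟨L, hL0, hL⟩ := exists_lipschitz_cutoff_mul_refPoly d q
  have hB : 0 < volume.real (Metric.ball (0 : E d) 1) :=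
    ENNReal.toReal_pos (Metric.measure_ball_pos _ _ one_pos).ne' measure_ball_lt_top.ne
  -- The relative mesh size for which the interpolation error is absorbed by coercivity.
  obtain ⟨η, hη0, hη, hsmall⟩ : ∃ η : ℝ, 0 < η ∧ η ≤ 1 / 4 ∧
      M * L * η * (κ₁ ^ d * volume.real (Metric.ball (0 : E d) 1)) ≤ c / 2 := by
    refine ⟨min (1 / 4) (c / 2 / (M * L * (κ₁ ^ d * volume.real (Metric.ball (0 : E d) 1)))),
      by positivity, min_le_left _ _, ?_⟩
    have h1 := min_le_right (1 / 4)
      (c / 2 / (M * L * (κ₁ ^ d * volume.real (Metric.ball (0 : E d) 1))))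
    rw [le_div_iff₀ (by positivity)] at h1
    linarith
  refine ⟨((η / κ₁ ^ 2) ^ d).toNNReal, Real.toNNReal_pos.2 (by positivity),
    (M ^ 2 * (κ₁ ^ d * volume.real (Metric.ball (0 : E d) 1)) / (c / 2)).toNNReal, ?_⟩
  intro Ω 𝒯 𝒮 hΩ h𝒯 h𝒮 href hσ
  exact exists_local_projector hd hq hΩ href (h𝒯.mono hκκ₁) (h𝒮.mono hκκ₁) hκ₁ hη0 hη hc0 hM0.le
    hL0.le hc hM hL hsmall hσ

end

end BiorthProj

end

open BiorthProj in
theorem lemma5p1 (d q : ℕ) (hd : 1 ≤ d) (hq : 1 ≤ q) (κ : ℝ) :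
    ∃ σ₀ : ℝ≥0, 0 < σ₀ ∧ ∃ C : ℝ≥0,
      ∀ (Ω : Set (E d)), IsOpen Ω →
      ∀ (Δ : Type*) (𝒯 𝒯S : Δ → ConformingMesh Ω),
        (∀ δ, (𝒯 δ).ShapeRegular κ) →
        (∀ δ, (𝒯S δ).ShapeRegular κ) →
        (∀ δ, (𝒯S δ).Refines (𝒯 δ)) →
        FixedMaximalDepth 𝒯S 𝒯 →
        (d = 1 → UniformKMesh 𝒯 ∧ UniformKMesh 𝒯S) →
        refinementRatio 𝒯S 𝒯 ≤ σ₀ →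
        ∃ P : Δ → (L2 Ω →L[ℝ] L2 Ω), ∀ δ,
          IsIdempotentElem (P δ) ∧
          (𝒯 δ).brokenPoly q ⊆ Set.range (ContinuousLinearMap.adjoint (P δ)) ∧
          Set.range (P δ) ⊆
            {w | w ∈ (𝒯S δ).conformingPoly q ∧ (𝒯 δ).VanishesOnSkeleton w} ∧
          ∀ T' ∈ (𝒯 δ).elems, ∀ w : L2 Ω,
            eLpNorm (P δ w) 2 ((volume.restrict Ω).restrict (hull T')) ≤
              C * eLpNorm w 2 ((volume.restrict Ω).restrict (hull T')) := by
  obtain ⟨σ₀, hσ₀, C, h⟩ := exists_uniform_projector hd hq κ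
  refine ⟨σ₀, hσ₀, C, fun Ω hΩ Δ 𝒯 𝒮 h𝒯 h𝒮 href _ _ hσ => ?_⟩
  choose P hP using fun δ => h (𝒯 δ) (𝒮 δ) hΩ (h𝒯 δ) (h𝒮 δ) (href δ) fun T hT U hU hUT =>
    le_trans (le_iSup_of_le δ (le_iSup₂_of_le T hT (le_iSup₂_of_le U hU
      (le_iSup (fun _ : hull U ⊆ hull T => volume (hull U) / volume (hull T)) hUT)))) hσ
  exact ⟨P, fun δ => ⟨(hP δ).idem, (hP δ).brokenPoly_subset, (hP δ).range_subset,
    (hP δ).eLpNorm_le⟩⟩
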